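/- Fix a prime base $b$, let $\mathbb N=\{1,2,\dots\}$, and let $\alpha\ge 2$ be an integer. For a symmetric positive semi-definite kernel $K:[0,1)\times[0,1)\to\mathbb R$ let $H(K)$ denote its reproducing kernel Hilbert space of real functions on $[0,1)$. For $k\in\mathbb N$ let $a_1>\dots>a_{\#k}\ge 0$ be the positions of the nonzero base-$b$ digits of $k=\sum_\ell \mathsf k_\ell b^\ell$, put $\mu_m(k)=\sum_{\ell=1}^{\min(m,\#k)}(a_\ell+1)$ and $\mu_m(0)=0$ for integers $m\ge0$, and let $k'$ be $k$ with its leading digit removed ($0'=0$, $k''=(k')'$). Let $\oplus,\ominus$ be digit-wise addition and subtraction modulo $b$ of the base-$b$ digit sequences of points of $[0,1)$ (expansions not ending in infinitely many digits $b-1$), and for a digit sequence $d=(\mathsf d_1,\mathsf d_2,\dots)$ let $\mathrm{wal}_k(d)=\exp\big(\tfrac{2\pi\sqrt{-1}}{b}\sum_{\ell\ge0}\mathsf k_\ell\,\mathsf d_{\ell+1}\big)$. (So $\mathrm{wal}_k(x\ominus x')$ is evaluated at the sequence of digit differences.) Define $$\dot K_\alpha(x,x')=\sum_{k\in\mathbb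 N} b^{-2\mu_\alpha(k)}\,\mathrm{wal}_k(x\ominus x'),\qquad \ddot K_{\alpha,\tau,\zeta}(x,x')=\sum_{k\in\mathbb N} b^{-\mu_\alpha(k)-\tau\mu_1(k')-\zeta\mu_{\alpha-2}(k'')}\,\mathrm{wal}_k(x\ominus x'),$$ $$\check K_\alpha(x,x')=\sum_{l=1}^{\alpha}\frac{B_l(x)B_l(x')}{(l!)^2}+\frac{(-1)^{\alpha+1}}{(2\alpha)!}B_{2\alpha}\big((x-x')\bmod 1\big),\qquad \check K_\alpha^{\mathrm{DSI}}(x,x')=\int_0^1\check K_\alpha(x\oplus\sigma,x'\oplus\sigma)\,\mathrm d\sigma,$$ where $B_l$ are the Bernoulli polynomials; in the last integral $x\oplus\sigma$ is read as a real number. The coefficients of the series for $\dot K_\alpha$ are summable, and so are those of the series for $\ddot K_{\alpha,\tau,\zeta}$ whenever $\tau>-1$ and $\zeta\ge-1$. We say that $\ddot K_{\alpha,\tau,\zeta}$ is well defined if its coefficients are summable, i.e. if its series converges on the diagonal. Then: 1. $H(\check K_\alpha^{\mathrm{DSI}})\subseteq H(\dot K_\alpha)$. 2. For all real $\tau<1$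 and $\zeta\le1$ for which $\ddot K_{\alpha,\tau,\zeta}$ is well defined, $H(\dot K_\alpha)\subseteq H(\ddot K_{\alpha,\tau,\zeta})$ and $H(\check K_\alpha)\subseteq H(\ddot K_{\alpha,\tau,\zeta})$. 3. For all real $\tau_2\le\tau_1<1$ and $\zeta_2\le\zeta_1\le1$ for which $\ddot K_{\alpha,\tau_2,\zeta_2}$ is well defined, $H(\ddot K_{\alpha,\tau_1,\zeta_1})\subseteq H(\ddot K_{\alpha,\tau_2,\zeta_2})$. -/

import Mathlib

open scoped Nat

noncomputable section

namespace DSI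

/-- The domain `[0,1)` of the kernels. -/
abbrev Unit01 : Type := Set.Ico (0 : ℝ) 1

/-- The reproducing kernel Hilbert space `H(K)` of a real kernel `K`, as a set of functions on `X`:
`f ∈ H(K)` if `f` belongs to a Hilbert space of real functions on `X` with continuous point
evaluations whose reproducing kernel is `K`.  (For symmetric positive semi-definite `K` this space
exists and is unique; if `K` is not of this kind, the set is empty.) -/
def rkhs {X : Type} (K : X → X → ℝ) : Set (X → ℝ) :=
  {f | ∃ (H : Type) (_ : NormedAddCommGroup H) (_ : InnerProductSpace ℝ H)
      (_ : CompleteSpace H) (_ : RKHS ℝ H X ℝ),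
      (∀ x y, RKHS.kernel H x y 1 = K x y) ∧ ∃ g : H, ⇑g = f}

/-- `H(K)` for a kernel on `[0,1)` given by a formula on `ℝ`: only its values on `[0,1)` matter. -/
def rkhs01 (K : ℝ → ℝ → ℝ) : Set (Unit01 → ℝ) :=
  rkhs fun x y : Unit01 => K x y

/-- The `k`-th Walsh function in base `b` at a sequence `(d₀, d₁, …)` of base `b` digits, standing
for the point `∑ d_ℓ b^(-ℓ-1)`.  The digit of index `ℓ` of `k` is `k / b ^ ℓ % b`; it is zero for
`ℓ > Nat.log b k`. -/
def walsh (b k : ℕ) (d : ℕ → Fin b) : ℂ :=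
  Complex.exp (2 * Real.pi * Complex.I / b *
    ∑ ℓ ∈ Finset.range (Nat.log b k + 1), (((k / b ^ ℓ % b) * (d ℓ : ℕ) : ℕ) : ℂ))

/-- Digit-wise addition `x ⊕ y` modulo `b` of points of `[0,1)`, as a real number.  The expansions
of `x` and `y` are those that do not end in infinitely many digits `b - 1`. -/
def digitAdd (b : ℕ) [NeZero b] (x y : ℝ) : ℝ :=
  Real.ofDigits (Real.digits x b + Real.digits y b)

/-- Digit-wise subtraction `x ⊖ y` modulo `b` of points of `[0,1)`, as a sequence of digits. -/
def digitSub (b : ℕ) [NeZero b] (x y : ℝ) : ℕ → Fin b :=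
  Real.digits x b - Real.digits y b

/-- `k'`: the number `k` with its leading (nonzero) base `b` digit removed; `0' = 0`. -/
def dropLead (b k : ℕ) : ℕ :=
  k % b ^ Nat.log b k

/-- The Dick weight `μ_α(k) = ∑_{ℓ=1}^{min(α,#k)} (a_ℓ + 1)`, where `a₁ > a₂ > … > a_{#k}` are the
positions of the nonzero base `b` digits of `k`.  Here `a₁ = Nat.log b k` for `k ≠ 0`, and
`a₂ > … > a_{#k}` are the positions belonging to `k'`. -/
def mu (b : ℕ) : ℕ → ℕ → ℕ
  | 0, _ => 0
  | α + 1, k => if k = 0 then 0 else (Nat.log b k + 1) + mu b α (dropLead b k)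

/-- The squared weight `ṙ_α²(k) = b^(-2 μ_α(k))`. -/
def dotWeightSq (b α k : ℕ) : ℝ :=
  (b : ℝ) ^ (-2 * (mu b α k : ℝ))

/-- The squared weight `r̈_{α,τ,ζ}²(k) = b^(-μ_α(k) - τ μ_1(k') - ζ μ_{α-2}(k''))` for `α ≥ 2`. -/
def ddotWeightSq (b α : ℕ) (τ ζ : ℝ) (k : ℕ) : ℝ :=
  (b : ℝ) ^ (-(mu b α k : ℝ) - τ * mu b 1 (dropLead b k)
    - ζ * mu b (α - 2) (dropLead b (dropLead b k)))

/-- The kernel `∑_{k ≥ 1} w(k) wal_k(x ⊖ y)`.  For the weights used here the sum is real: they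
depend only on the positions of the nonzero digits of `k`, so the terms come in conjugate pairs. -/
def walshKernel (b : ℕ) [NeZero b] (w : ℕ → ℝ) (x y : ℝ) : ℝ :=
  (∑' k : ℕ+, (w k : ℂ) * walsh b k (digitSub b x y)).re

/-- The kernel `K̇_α`. -/
def dotKernel (b : ℕ) [NeZero b] (α : ℕ) : ℝ → ℝ → ℝ :=
  walshKernel b (dotWeightSq b α)

/-- The kernel `K̈_{α,τ,ζ}`. -/
def ddotKernel (b : ℕ) [NeZero b] (α : ℕ) (τ ζ : ℝ) : ℝ → ℝ → ℝ :=
  walshKernel b (ddotWeightSq b α τ ζ)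

/-- The kernel `Ǩ_α(x,y) = ∑_{l=1}^α B_l(x) B_l(y) / (l!)²
+ (-1)^(α+1) / (2α)! B_{2α}((x-y) mod 1)` of the Sobolev space of order `α` of functions on `[0,1)`
with integral zero. -/
def sobolevKernel (α : ℕ) (x y : ℝ) : ℝ :=
  ∑ l ∈ Finset.Icc 1 α, bernoulliFun l x * bernoulliFun l y / ((l ! : ℕ) : ℝ) ^ 2
    + (-1) ^ (α + 1) / (((2 * α)! : ℕ) : ℝ) * bernoulliFun (2 * α) (Int.fract (x - y))

/-- The associated digitally-shift-invariant kernel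
`K^DSI(x,y) = ∫₀¹ K(x ⊕ σ, y ⊕ σ) dσ`. -/
def dsiKernel (b : ℕ) [NeZero b] (K : ℝ → ℝ → ℝ) (x y : ℝ) : ℝ :=
  ∫ σ in Set.Ico (0 : ℝ) 1, K (digitAdd b x σ) (digitAdd b y σ)

end DSI

end

/-!
The space `H(K)` grows with `K` in the order of quadratic forms, up to constant factors, so each
inclusion is an inequality between quadratic forms. The quadratic form of a kernel
`∑ w(k) wal_k(x ⊖ y)` at points `x` with coefficients `c(x)` is `∑ w(k) |S_k|²`, where
`S_k = ∑ c(x) wal_k(x)`; hence enlarging the weights enlarges the space.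

The Fourier series of the Bernoulli polynomials turns the quadratic form of `Ǩ_α` into a
superposition of squares `(∑ c(x) F(x))²`, where `F` is `B_l / l!` with `1 ≤ l ≤ α` or a translate
of the periodic function `B_α({·}) / α!`. Each of these features `F` has mean zero, and its Walsh
coefficients satisfy `|F̂(k)| ≤ M b ^ (-μ_α(k))`: integrating by parts gains the leading digit of
`k` and replaces `k` by `k'` and `F` by `F'`, and the jump of `B_1({·})` costs nothing because a
monotone function has Walsh coefficients of order `b ^ (-μ_1(k))`.

Therefore `∑ c(x) F(x) = ∑ F̂(k) S_k`. By Cauchy–Schwarz its square is at most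
`(∑ |F̂(k)|² / w(k)) ∑ w(k) |S_k|²`, whose first factor is finite for the weights `w` of
`K̈_{α,τ,ζ}` if `τ < 1` and `ζ ≤ 1`. A digital shift by `σ` multiplies `S_k` by `wal_k(σ)`, so by
Parseval the mean of the square over all shifts is
`∑ |F̂(k)|² |S_k|² ≤ M² ∑ b ^ (-2 μ_α(k)) |S_k|²`, with no loss.
-/

namespace DSI

/-! ### Inclusions of reproducing kernel Hilbert spaces -/

section RKHSInclusion

variable {X : Type}

/-- The quadratic form of the kernel `K`, evaluated at the family `c` supported on the finite
set `s`. -/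
noncomputable def quadForm (K : X → X → ℝ) (s : Finset X) (c : X → ℝ) : ℝ :=
  ∑ x ∈ s, ∑ y ∈ s, c x * c y * K x y

/-- Domination `K ≤ C K'` of kernels, up to a constant factor, in the order of quadratic forms. -/
def IsDominated (K K' : X → X → ℝ) : Prop :=
  ∃ C : ℝ, 0 ≤ C ∧ ∀ s c, quadForm K s c ≤ C * quadForm K' s c

theorem posSemidef_of_quadForm_nonneg {K : X → X → ℝ} (hsymm : ∀ x y, K x y = K y x)
    (hpos : ∀ s c, 0 ≤ quadForm K s c) : (Matrix.of K).PosSemidef := by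
  refine ⟨Matrix.IsHermitian.ext fun x y => by simp [hsymm x y], fun c => ?_⟩
  refine (hpos c.support c).trans_eq ?_
  exact Finset.sum_congr rfl fun x _ => Finset.sum_congr rfl fun y _ => by
    simp only [Matrix.of_apply, star_trivial]; ring

theorem exists_inner_eq_of_abs_le {V H : Type*} [AddCommGroup V] [Module ℝ V]
    [NormedAddCommGroup H] [InnerProductSpace ℝ H] [CompleteSpace H]
    (T : V →ₗ[ℝ] H) (L : V →ₗ[ℝ] ℝ) (C : ℝ) (h : ∀ v, |L v| ≤ C * ‖T v‖) :
    ∃ g : H, ∀ v, inner ℝ g (T v) = L v := by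
  have hker : LinearMap.ker T ≤ LinearMap.ker L := fun v hv => by
    have := h v
    rw [LinearMap.mem_ker.1 hv, norm_zero, mul_zero] at this
    exact LinearMap.mem_ker.2 (abs_nonpos_iff.1 this)
  let L₁ : LinearMap.range T →ₗ[ℝ] ℝ :=
    ((LinearMap.ker T).liftQ L hker).comp (T.quotKerEquivRange.symm : _ →ₗ[ℝ] _)
  have hL₁ : ∀ v, L₁ ⟨T v, LinearMap.mem_range_self T v⟩ = L v := fun v => by
    have : T.quotKerEquivRange.symm ⟨T v, LinearMap.mem_range_self T v⟩
        = (LinearMap.ker T).mkQ v := T.quotKerEquivRange_symm_apply_image v _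
    simp [L₁, this]
  let L₂ : StrongDual ℝ (LinearMap.range T) := L₁.mkContinuous C (by
    rintro ⟨_, v, rfl⟩
    rw [hL₁]
    exact h v)
  obtain ⟨g, hg, -⟩ := exists_extension_norm_eq _ L₂
  refine ⟨(InnerProductSpace.toDual ℝ H).symm g, fun v => ?_⟩
  rw [InnerProductSpace.toDual_symm_apply, hg ⟨T v, LinearMap.mem_range_self T v⟩]
  exact hL₁ v

theorem norm_sum_kerFun_sq {H : Type} [NormedAddCommGroup H] [InnerProductSpace ℝ H]
    [CompleteSpace H] [RKHS ℝ H X ℝ] {K : X → X → ℝ}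
    (hk : ∀ x y, RKHS.kernel H x y 1 = K x y) (s : Finset X) (c : X → ℝ) :
    ‖∑ x ∈ s, c x • RKHS.kerFun H x (1 : ℝ)‖ ^ 2 = quadForm K s c := by
  rw [← real_inner_self_eq_norm_sq]
  simp only [sum_inner, inner_sum, quadForm,
    real_inner_smul_left, real_inner_smul_right, RKHS.kerFun_inner, RKHS.kerFun_apply, hk]
  rw [Finset.sum_comm]
  refine Finset.sum_congr rfl fun x _ => Finset.sum_congr rfl fun y _ => ?_
  simp only [Real.ringHom_apply, RCLike.inner_apply, mul_one]
  ring

theorem posSemidef_smul_id {K : X → X → ℝ} (hK : (Matrix.of K).PosSemidef) :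
    (Matrix.of fun x y => K x y • ContinuousLinearMap.id ℝ ℝ).PosSemidef := by
  have hiff := RKHS.posSemidef_tfae (K := Matrix.of fun x y => K x y • ContinuousLinearMap.id ℝ ℝ)
    |>.out 0 2
  refine hiff.2 ⟨?_, fun c => ?_⟩
  · have hsymm : ∀ x y, K y x = K x y := fun x y => hK.1.apply x y
    refine Matrix.IsHermitian.ext fun x y => ContinuousLinearMap.ext_ring ?_
    simp [ContinuousLinearMap.star_eq_adjoint, ContinuousLinearMap.adjoint_id, hsymm x y]
  · refine (hK.2 c).trans_eq ?_
    rw [Finsupp.sum_comm]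
    exact Finset.sum_congr rfl fun x _ => Finset.sum_congr rfl fun y _ => by
      simp [mul_comm, mul_left_comm]

theorem mem_rkhs_of_sq_le {K : X → X → ℝ} (hK : (Matrix.of K).PosSemidef) {f : X → ℝ} {C : ℝ}
    (hC : 0 ≤ C) (hf : ∀ s c, (∑ x ∈ s, c x * f x) ^ 2 ≤ C * quadForm K s c) : f ∈ rkhs K := by
  let M : Matrix X X (ℝ →L[ℝ] ℝ) := .of fun x y => K x y • ContinuousLinearMap.id ℝ ℝ
  have : Fact M.PosSemidef := ⟨posSemidef_smul_id hK⟩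
  have hk : ∀ x y, RKHS.kernel (RKHS.OfKernel M) x y 1 = K x y := fun x y => by
    simp [RKHS.OfKernel.kernel_ofKernel, M]
  let T : (X →₀ ℝ) →ₗ[ℝ] RKHS.OfKernel M :=
    Finsupp.linearCombination ℝ fun x => RKHS.kerFun (RKHS.OfKernel M) x (1 : ℝ)
  let L : (X →₀ ℝ) →ₗ[ℝ] ℝ := Finsupp.linearCombination ℝ f
  have hT : ∀ c, ‖T c‖ ^ 2 = quadForm K c.support c := fun c =>
    norm_sum_kerFun_sq hk c.support c
  have hL : ∀ c, |L c| ≤ √C * ‖T c‖ := fun c => by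
    refine abs_le_of_sq_le_sq ?_ (by positivity)
    rw [mul_pow, Real.sq_sqrt hC, hT]
    exact hf c.support c
  obtain ⟨g, hg⟩ := exists_inner_eq_of_abs_le T L (√C) hL
  refine ⟨RKHS.OfKernel M, inferInstance, inferInstance, inferInstance, inferInstance, hk, g, ?_⟩
  ext x
  simpa [T, L] using hg (Finsupp.single x 1)

theorem rkhs_subset_of_isDominated {K K' : X → X → ℝ} (hK' : (Matrix.of K').PosSemidef)
    (h : IsDominated K K') : rkhs K ⊆ rkhs K' := by
  obtain ⟨C, hC, hdom⟩ := h
  rintro f ⟨H, _, _, _, _, hk, g, rfl⟩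
  refine mem_rkhs_of_sq_le hK' (C := ‖g‖ ^ 2 * C) (by positivity) fun s c => ?_
  let v : H := ∑ x ∈ s, c x • RKHS.kerFun H x (1 : ℝ)
  have hrep : ∑ x ∈ s, c x * g x = inner ℝ v g := by
    simp [v, sum_inner, real_inner_smul_left]
  calc (∑ x ∈ s, c x * g x) ^ 2 ≤ (‖v‖ * ‖g‖) ^ 2 := by
        rw [hrep, ← sq_abs]
        exact pow_le_pow_left₀ (abs_nonneg _) (abs_real_inner_le_norm v g) 2
    _ = ‖g‖ ^ 2 * quadForm K s c := by rw [mul_pow, norm_sum_kerFun_sq hk, mul_comm]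
    _ ≤ ‖g‖ ^ 2 * C * quadForm K' s c := by
        rw [mul_assoc]
        exact mul_le_mul_of_nonneg_left (hdom s c) (by positivity)

end RKHSInclusion

/-! ### Walsh functions -/

section Walsh

variable {b : ℕ}

/-- The primitive `b`-th root of unity `exp(2πi/b)`; its powers are the values of the Walsh
functions. -/
noncomputable def rootOfUnity (b : ℕ) : ℂ := Complex.exp (2 * Real.pi * Complex.I / b)

theorem isPrimitiveRoot_rootOfUnity (hb : 1 < b) : IsPrimitiveRoot (rootOfUnity b) b :=
  Complex.isPrimitiveRoot_exp b (by omega)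

theorem norm_rootOfUnity (hb : 1 < b) : ‖rootOfUnity b‖ = 1 :=
  (isPrimitiveRoot_rootOfUnity hb).norm'_eq_one (by omega)

theorem sum_rootOfUnity_mul_conj (hb : 1 < b) {d e : ℕ} (hd : d < b) (he : e < b) :
    ∑ κ ∈ Finset.range b, rootOfUnity b ^ (d * κ) * starRingEnd ℂ (rootOfUnity b ^ (e * κ))
      = if d = e then (b : ℂ) else 0 := by
  have hω := isPrimitiveRoot_rootOfUnity hb
  have hnorm : ∀ m, ‖rootOfUnity b ^ m‖ = 1 := fun m => by
    rw [norm_pow, norm_rootOfUnity hb, one_pow]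
  set r := rootOfUnity b ^ d / rootOfUnity b ^ e with hr
  have hterm : ∀ κ, rootOfUnity b ^ (d * κ) * starRingEnd ℂ (rootOfUnity b ^ (e * κ)) = r ^ κ :=
    fun κ => by rw [← Complex.inv_eq_conj (hnorm _), hr, div_pow, pow_mul, pow_mul, div_eq_mul_inv]
  have he0 : rootOfUnity b ^ e ≠ 0 := norm_ne_zero_iff.1 (by simp [hnorm])
  simp only [hterm]
  split_ifs with h
  · simp [hr, h, he0]
  · have hr1 : r ≠ 1 := fun h1 => h (hω.pow_inj hd he ((div_eq_one_iff_eq he0).1 h1))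
    have hrb : r ^ b = 1 := by
      rw [hr, div_pow, ← pow_mul', ← pow_mul', pow_mul, pow_mul, hω.pow_eq_one]
      simp
    rw [geom_sum_eq hr1, hrb, sub_self, zero_div]

theorem sum_rootOfUnity_pow (hb : 1 < b) {d : ℕ} (hd : d < b) :
    ∑ κ ∈ Finset.range b, rootOfUnity b ^ (κ * d) = if d = 0 then (b : ℂ) else 0 := by
  simpa [mul_comm] using sum_rootOfUnity_mul_conj hb hd (e := 0) (by omega)

theorem digit_eq_zero_of_lt {k n ℓ : ℕ} (hb : 1 < b) (hk : k < b ^ n) (h : n ≤ ℓ) :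
    k / b ^ ℓ % b = 0 := by
  rw [Nat.div_eq_of_lt (hk.trans_le (Nat.pow_le_pow_right hb.le h)), Nat.zero_mod]

theorem walsh_eq_prod (hb : 1 < b) {k n : ℕ} (hk : k < b ^ n) (d : ℕ → Fin b) :
    walsh b k d = ∏ ℓ ∈ Finset.range n, rootOfUnity b ^ ((k / b ^ ℓ % b) * (d ℓ : ℕ)) := by
  have hlog : k < b ^ (Nat.log b k + 1) := Nat.lt_pow_succ_log_self hb k
  have htail : ∀ N, k < b ^ N → ∀ ℓ ∉ Finset.range N,
      rootOfUnity b ^ ((k / b ^ ℓ % b) * (d ℓ : ℕ)) = 1 := fun N hN ℓ hℓ => by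
    rw [digit_eq_zero_of_lt hb hN (by simpa using hℓ), zero_mul, pow_zero]
  calc walsh b k d
      = ∏ ℓ ∈ Finset.range (Nat.log b k + 1), rootOfUnity b ^ ((k / b ^ ℓ % b) * (d ℓ : ℕ)) := by
        rw [walsh, Finset.mul_sum, Complex.exp_sum]
        refine Finset.prod_congr rfl fun ℓ _ => ?_
        rw [rootOfUnity, ← Complex.exp_nat_mul, mul_comm]
    _ = ∏ᶠ ℓ, rootOfUnity b ^ ((k / b ^ ℓ % b) * (d ℓ : ℕ)) :=
        (finprod_eq_prod_of_mulSupport_subset _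
          (Function.mulSupport_subset_iff'.2 (by simpa using htail _ hlog))).symm
    _ = _ := finprod_eq_prod_of_mulSupport_subset _
          (Function.mulSupport_subset_iff'.2 (by simpa using htail _ hk))

theorem walsh_zero (hb : 1 < b) (d : ℕ → Fin b) : walsh b 0 d = 1 := by
  rw [walsh_eq_prod hb (n := 0) (by simp), Finset.prod_range_zero]

theorem norm_walsh (hb : 1 < b) (k : ℕ) (d : ℕ → Fin b) : ‖walsh b k d‖ = 1 := by
  rw [walsh_eq_prod hb (Nat.lt_pow_succ_log_self hb k), norm_prod]
  exact Finset.prod_eq_one fun ℓ _ => by rw [norm_pow, norm_rootOfUnity hb, one_pow]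

@[fun_prop]
theorem continuous_walsh (k : ℕ) : Continuous (walsh b k) := by
  unfold walsh
  fun_prop

theorem continuous_tsum_mul_walsh (hb : 1 < b) {A : ℕ → ℂ} (hA : Summable fun k => ‖A k‖) :
    Continuous fun d => ∑' k, A k * walsh b k d :=
  continuous_tsum (fun k => by fun_prop) hA fun k d => by rw [norm_mul, norm_walsh hb, mul_one]

theorem walsh_mul_pow_add (hb : 1 < b) {κ k n : ℕ} (hκ : κ < b) (hk : k < b ^ n)
    (d : ℕ → Fin b) :
    walsh b (κ * b ^ n + k) d = rootOfUnity b ^ (κ * (d n : ℕ)) * walsh b k d := by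
  have hpos : 0 < b ^ n := by positivity
  have hlt : κ * b ^ n + k < b ^ (n + 1) := by
    calc κ * b ^ n + k < (κ + 1) * b ^ n := by rw [add_mul, one_mul]; omega
      _ ≤ b ^ (n + 1) := by rw [pow_succ']; exact Nat.mul_le_mul_right _ hκ
  have hlow : ∀ ℓ < n, (κ * b ^ n + k) / b ^ ℓ % b = k / b ^ ℓ % b := fun ℓ hℓ => by
    obtain ⟨m, rfl⟩ := Nat.exists_eq_add_of_lt hℓ
    rw [show κ * b ^ (ℓ + m + 1) + k = b ^ ℓ * (b * (κ * b ^ m)) + k by ring,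
      Nat.mul_add_div (by positivity), Nat.mul_add_mod]
  have htop : (κ * b ^ n + k) / b ^ n % b = κ := by
    rw [mul_comm, Nat.mul_add_div hpos, Nat.div_eq_of_lt hk, add_zero, Nat.mod_eq_of_lt hκ]
  rw [walsh_eq_prod hb hlt, walsh_eq_prod hb hk, Finset.prod_range_succ, htop, mul_comm]
  congr 1
  exact Finset.prod_congr rfl fun ℓ hℓ => by rw [hlow ℓ (Finset.mem_range.1 hℓ)]

theorem sum_range_mul {M : Type*} [AddCommMonoid M] (f : ℕ → M) (m n : ℕ) :
    ∑ k ∈ Finset.range (m * n), f k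
      = ∑ i ∈ Finset.range m, ∑ j ∈ Finset.range n, f (i * n + j) := by
  induction m with
  | zero => simp
  | succ m ih => rw [add_mul, one_mul, Finset.sum_range_add, ih, Finset.sum_range_succ]

theorem walsh_add (hb : 1 < b) (k : ℕ) (d e : ℕ → Fin b) :
    walsh b k (d + e) = walsh b k d * walsh b k e := by
  have hk := Nat.lt_pow_succ_log_self hb k
  rw [walsh_eq_prod hb hk, walsh_eq_prod hb hk, walsh_eq_prod hb hk, ← Finset.prod_mul_distrib]
  refine Finset.prod_congr rfl fun ℓ _ => ?_
  rw [← pow_add, ← mul_add, Pi.add_apply, Fin.val_add, pow_mul', pow_mul',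
    ← pow_eq_pow_mod _ (isPrimitiveRoot_rootOfUnity hb).pow_eq_one]

variable [NeZero b]

theorem walsh_sub (hb : 1 < b) (k : ℕ) (d e : ℕ → Fin b) :
    walsh b k (d - e) = walsh b k d * starRingEnd ℂ (walsh b k e) := by
  have he : walsh b k e ≠ 0 := norm_ne_zero_iff.1 (by simp [norm_walsh hb])
  rw [← Complex.inv_eq_conj (norm_walsh hb k e), ← div_eq_mul_inv, eq_div_iff he,
    ← walsh_add hb, sub_add_cancel]

theorem walsh_single (hb : 1 < b) (k n : ℕ) (c : Fin b) :
    walsh b k (Pi.single n c) = rootOfUnity b ^ ((k / b ^ n % b) * (c : ℕ)) := by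
  have hk : k < b ^ (max (Nat.log b k + 1) (n + 1)) :=
    (Nat.lt_pow_succ_log_self hb k).trans_le (Nat.pow_le_pow_right hb.le (le_max_left _ _))
  rw [walsh_eq_prod hb hk, Finset.prod_eq_single n]
  · rw [Pi.single_eq_same]
  · intro ℓ _ hℓ
    rw [Pi.single_eq_of_ne hℓ, Fin.val_zero, mul_zero, pow_zero]
  · exact fun hn => absurd (Finset.mem_range.2 (lt_max_of_lt_right n.lt_succ_self)) hn

theorem walsh_apply_zero (k : ℕ) : walsh b k 0 = 1 := by
  simp [walsh]

theorem sum_walsh (hb : 1 < b) (n : ℕ) (d : ℕ → Fin b) :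
    ∑ k ∈ Finset.range (b ^ n), walsh b k d = if ∀ ℓ < n, d ℓ = 0 then (b : ℂ) ^ n else 0 := by
  induction n with
  | zero => simp [walsh_zero hb]
  | succ n ih =>
    have hsplit : ∑ k ∈ Finset.range (b ^ (n + 1)), walsh b k d
        = (∑ κ ∈ Finset.range b, rootOfUnity b ^ (κ * (d n : ℕ)))
          * ∑ k ∈ Finset.range (b ^ n), walsh b k d := by
      rw [pow_succ', sum_range_mul, Finset.sum_mul_sum]
      exact Finset.sum_congr rfl fun κ hκ => Finset.sum_congr rfl fun k hk =>
        walsh_mul_pow_add hb (Finset.mem_range.1 hκ) (Finset.mem_range.1 hk) d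
    rw [hsplit, sum_rootOfUnity_pow hb (d n).isLt, ih, ite_zero_mul_ite_zero, pow_succ']
    simp only [Fin.val_eq_zero_iff, Nat.forall_lt_succ_right, and_comm]

end Walsh

/-! ### Harmonic analysis on the group of digit sequences -/

section DigitMeasure

open MeasureTheory Filter Topology

theorem eventually_cylinder_subset {E : ℕ → Type*} [∀ n, TopologicalSpace (E n)]
    [∀ n, DiscreteTopology (E n)] {d : ∀ n, E n} {U : Set (∀ n, E n)} (hU : U ∈ 𝓝 d) :
    ∀ᶠ n in atTop, PiNat.cylinder d n ⊆ U := by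
  obtain ⟨_, ⟨x, N, rfl⟩, hd, hsub⟩ := (PiNat.isTopologicalBasis_cylinders E).mem_nhds_iff.1 hU
  rw [← PiNat.mem_cylinder_iff_eq.1 hd] at hsub
  filter_upwards [eventually_ge_atTop N] with n hn
  exact (PiNat.cylinder_anti d hn).trans hsub

variable {b : ℕ} [NeZero b]

/-- The law of the digit sequence of a uniformly distributed point of `[0,1)`, which is the
normalised Haar measure of the compact group of digit sequences. -/
noncomputable def digitMeasure (b : ℕ) [NeZero b] : Measure (ℕ → Fin b) :=
  (volume.restrict (Set.Ico (0 : ℝ) 1)).map (Real.digits · b)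

theorem measurable_digits : Measurable fun x : ℝ => Real.digits x b :=
  measurable_pi_lambda _ fun ℓ =>
    (measurable_of_countable (Fin.ofNat b)).comp (Nat.measurable_floor.comp (by fun_prop))

instance isProbabilityMeasure_digitMeasure : IsProbabilityMeasure (digitMeasure b) := by
  have : IsProbabilityMeasure (volume.restrict (Set.Ico (0 : ℝ) 1)) := ⟨by simp⟩
  exact Measure.isProbabilityMeasure_map measurable_digits.aemeasurable

theorem integral_digitMeasure {E : Type*} [NormedAddCommGroup E] [NormedSpace ℝ E]
    {G : (ℕ → Fin b) → E} (hG : Continuous G) :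
    ∫ d, G d ∂digitMeasure b = ∫ σ in Set.Ico (0 : ℝ) 1, G (Real.digits σ b) :=
  integral_map measurable_digits.aemeasurable hG.aestronglyMeasurable

theorem integrable_digitMeasure {E : Type*} [NormedAddCommGroup E] {G : (ℕ → Fin b) → E}
    (hG : Continuous G) : Integrable G (digitMeasure b) :=
  hG.integrable_of_hasCompactSupport (.of_compactSpace G)

/-- The base `b` digits of the grid point `j / b ^ n`. -/
noncomputable def gridDigits (b : ℕ) [NeZero b] (n j : ℕ) : ℕ → Fin b :=
  Real.digits ((j : ℝ) / (b : ℝ) ^ n) b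

theorem gridDigits_of_lt {n ℓ : ℕ} (hℓ : ℓ < n) (j : ℕ) :
    gridDigits b n j ℓ = Fin.ofNat b (j / b ^ (n - 1 - ℓ)) := by
  have hb0 : (b : ℝ) ≠ 0 := Nat.cast_ne_zero.2 (NeZero.ne b)
  obtain ⟨m, rfl⟩ := Nat.exists_eq_add_of_lt hℓ
  have hpoint : (j : ℝ) / (b : ℝ) ^ (ℓ + m + 1) * (b : ℝ) ^ (ℓ + 1) = j / ((b ^ m : ℕ) : ℝ) := by
    rw [add_right_comm ℓ m 1, pow_add]
    push_cast
    field_simp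
  rw [gridDigits, Real.digits, hpoint, Nat.floor_div_natCast, Nat.floor_natCast]
  congr 3
  omega

theorem gridDigits_of_le {n ℓ : ℕ} (hℓ : n ≤ ℓ) (j : ℕ) : gridDigits b n j ℓ = 0 := by
  have hb0 : (b : ℝ) ≠ 0 := Nat.cast_ne_zero.2 (NeZero.ne b)
  obtain ⟨m, rfl⟩ := Nat.exists_eq_add_of_le hℓ
  have hpoint : (j : ℝ) / (b : ℝ) ^ n * (b : ℝ) ^ (n + m + 1) = ((b * (j * b ^ m) : ℕ) : ℝ) := by
    rw [div_mul_eq_mul_div, div_eq_iff (pow_ne_zero n hb0)]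
    push_cast
    ring
  rw [gridDigits, Real.digits, hpoint, Nat.floor_natCast]
  exact Fin.ext (by simp)

theorem gridDigits_zero (j : ℕ) : gridDigits b 0 j = 0 :=
  funext fun ℓ => gridDigits_of_le ℓ.zero_le j

theorem gridDigits_succ {d : ℕ} (n j : ℕ) (hd : d < b) :
    gridDigits b (n + 1) (j * b + d) = gridDigits b n j + Pi.single n (Fin.ofNat b d) := by
  ext ℓ
  rw [Pi.add_apply]
  rcases lt_trichotomy ℓ n with hℓ | rfl | hℓ
  · rw [Pi.single_eq_of_ne hℓ.ne, add_zero, gridDigits_of_lt hℓ, gridDigits_of_lt (by omega),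
      show n + 1 - 1 - ℓ = n - 1 - ℓ + 1 by omega, pow_succ', ← Nat.div_div_eq_div_mul,
      mul_comm j, Nat.mul_add_div (by omega), Nat.div_eq_of_lt hd, add_zero]
  · rw [Pi.single_eq_same, gridDigits_of_le le_rfl, zero_add, gridDigits_of_lt (Nat.lt_succ_self _)]
    simp
  · rw [Pi.single_eq_of_ne hℓ.ne', gridDigits_of_le hℓ.le, gridDigits_of_le hℓ, add_zero]

theorem digits_eq_gridDigits_floor (σ : ℝ) {n ℓ : ℕ} (hℓ : ℓ < n) :
    Real.digits σ b ℓ = gridDigits b n ⌊σ * ((b ^ n : ℕ) : ℝ)⌋₊ ℓ := by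
  have hb0 : (b : ℝ) ≠ 0 := Nat.cast_ne_zero.2 (NeZero.ne b)
  obtain ⟨m, rfl⟩ := Nat.exists_eq_add_of_lt hℓ
  rw [gridDigits_of_lt hℓ, Real.digits, ← Nat.floor_div_natCast,
    show ℓ + m + 1 - 1 - ℓ = m by omega, add_right_comm ℓ m 1, pow_add b]
  push_cast
  rw [← mul_assoc, mul_div_cancel_right₀ _ (pow_ne_zero m hb0)]

theorem walsh_gridDigits_succ {d : ℕ} (hb : 1 < b) (k n j : ℕ) (hd : d < b) :
    walsh b k (gridDigits b (n + 1) (j * b + d))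
      = walsh b k (gridDigits b n j) * rootOfUnity b ^ ((k / b ^ n % b) * d) := by
  rw [gridDigits_succ n j hd, walsh_add hb, walsh_single hb, Fin.val_ofNat, Nat.mod_eq_of_lt hd]

theorem sum_walsh_gridDigits_mul_conj (hb : 1 < b) (k l n : ℕ) :
    ∑ j ∈ Finset.range (b ^ n),
      walsh b k (gridDigits b n j) * starRingEnd ℂ (walsh b l (gridDigits b n j))
        = if k % b ^ n = l % b ^ n then (b : ℂ) ^ n else 0 := by
  have hbpos : 0 < b := by omega
  induction n with
  | zero => simp [Nat.mod_one, gridDigits_zero, walsh_apply_zero]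
  | succ n ih =>
    have hsplit : ∑ j ∈ Finset.range (b ^ (n + 1)), walsh b k (gridDigits b (n + 1) j)
          * starRingEnd ℂ (walsh b l (gridDigits b (n + 1) j))
        = (∑ j ∈ Finset.range (b ^ n),
            walsh b k (gridDigits b n j) * starRingEnd ℂ (walsh b l (gridDigits b n j)))
          * ∑ d ∈ Finset.range b, rootOfUnity b ^ ((k / b ^ n % b) * d)
            * starRingEnd ℂ (rootOfUnity b ^ ((l / b ^ n % b) * d)) := by
      rw [pow_succ, sum_range_mul, Finset.sum_mul_sum]
      refine Finset.sum_congr rfl fun j _ => Finset.sum_congr rfl fun d hd => ?_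
      rw [walsh_gridDigits_succ hb _ _ _ (Finset.mem_range.1 hd),
        walsh_gridDigits_succ hb _ _ _ (Finset.mem_range.1 hd), map_mul, mul_mul_mul_comm]
    have hmod : k % b ^ (n + 1) = l % b ^ (n + 1)
        ↔ k % b ^ n = l % b ^ n ∧ k / b ^ n % b = l / b ^ n % b := by
      refine ⟨fun h => ⟨?_, ?_⟩, fun h => by rw [Nat.mod_pow_succ, Nat.mod_pow_succ, h.1, h.2]⟩
      · rw [← Nat.mod_mod_of_dvd k (pow_dvd_pow b n.le_succ), h,
          Nat.mod_mod_of_dvd _ (pow_dvd_pow b n.le_succ)]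
      · rw [← Nat.mod_mul_right_div_self, ← Nat.mod_mul_right_div_self, ← pow_succ, h]
    rw [hsplit, ih, sum_rootOfUnity_mul_conj hb (Nat.mod_lt _ hbpos) (Nat.mod_lt _ hbpos),
      ite_zero_mul_ite_zero, ← pow_succ]
    simp only [hmod]

theorem setIntegral_floor_mul_eq_sum (g : ℕ → ℂ) {N : ℕ} (hN : N ≠ 0) :
    ∫ σ in Set.Ico (0 : ℝ) 1, g ⌊σ * N⌋₊ = (N : ℂ)⁻¹ * ∑ j ∈ Finset.range N, g j := by
  have hN0 : (N : ℝ) ≠ 0 := Nat.cast_ne_zero.2 hN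
  have hfloor : ∀ j : ℕ, Set.EqOn (fun _ => g j) (fun τ : ℝ => g ⌊τ⌋₊)
      (Set.uIoo (j : ℝ) ((j + 1 : ℕ) : ℝ)) := fun j τ hτ => by
    rw [Set.uIoo_of_le (by simp)] at hτ
    have : ⌊τ⌋₊ = j := (Nat.floor_eq_iff (j.cast_nonneg.trans hτ.1.le)).2
      ⟨hτ.1.le, by simpa using hτ.2⟩
    simp only [this]
  have hint : ∀ j < N, IntervalIntegrable (fun τ : ℝ => g ⌊τ⌋₊) volume (j : ℝ) ((j + 1 : ℕ) : ℝ) :=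
    fun j _ => (intervalIntegrable_const (c := g j)).congr_uIoo (hfloor j)
  have hsum := intervalIntegral.sum_integral_adjacent_intervals hint
  rw [integral_Ico_eq_integral_Ioc, ← intervalIntegral.integral_of_le zero_le_one,
    intervalIntegral.integral_comp_mul_right (fun τ => g ⌊τ⌋₊) hN0, zero_mul, one_mul,
    ← Nat.cast_zero, ← hsum, Complex.real_smul]
  push_cast
  congr 1
  refine Finset.sum_congr rfl fun j _ => ?_
  have := intervalIntegral.integral_congr_uIoo (μ := volume) (hfloor j)
  push_cast at this
  rw [← this]
  simp

theorem tendsto_mean_gridDigits {G : (ℕ → Fin b) → ℂ} (hG : Continuous G) :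
    Tendsto (fun n => ((b : ℂ) ^ n)⁻¹ * ∑ j ∈ Finset.range (b ^ n), G (gridDigits b n j)) atTop
      (𝓝 (∫ d, G d ∂digitMeasure b)) := by
  obtain ⟨C, hC⟩ := isCompact_univ.exists_bound_of_continuousOn hG.continuousOn
  have hfloor : ∀ n, ((b : ℂ) ^ n)⁻¹ * ∑ j ∈ Finset.range (b ^ n), G (gridDigits b n j)
      = ∫ σ in Set.Ico (0 : ℝ) 1, G (gridDigits b n ⌊σ * ((b ^ n : ℕ) : ℝ)⌋₊) := fun n => by
    rw [setIntegral_floor_mul_eq_sum (fun j => G (gridDigits b n j)) (pow_ne_zero n (NeZero.ne b)),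
      Nat.cast_pow]
  have hlim : ∀ σ : ℝ, Tendsto (fun n => gridDigits b n ⌊σ * ((b ^ n : ℕ) : ℝ)⌋₊) atTop
      (𝓝 (Real.digits σ b)) := fun σ => tendsto_pi_nhds.2 fun ℓ =>
    tendsto_const_nhds.congr' (eventually_gt_atTop ℓ |>.mono fun n hn =>
      digits_eq_gridDigits_floor σ hn)
  simp only [hfloor, integral_digitMeasure hG]
  refine tendsto_integral_of_dominated_convergence (fun _ => C) (fun n => ?_) (integrable_const C)
    (fun n => .of_forall fun σ => hC _ (Set.mem_univ _))
    (.of_forall fun σ => (hG.tendsto _).comp (hlim σ))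
  exact ((measurable_of_countable fun j => G (gridDigits b n j)).comp
    (Nat.measurable_floor.comp (by fun_prop))).aestronglyMeasurable

theorem integral_walsh_mul_conj (hb : 1 < b) (k l : ℕ) :
    ∫ d, walsh b k d * starRingEnd ℂ (walsh b l d) ∂digitMeasure b = if k = l then 1 else 0 := by
  refine tendsto_nhds_unique (tendsto_mean_gridDigits (by fun_prop))
    (tendsto_const_nhds.congr' ?_)
  have hlarge : ∀ m : ℕ, ∀ᶠ n in atTop, m < b ^ n := fun m =>
    (tendsto_pow_atTop_atTop_of_one_lt hb).eventually_gt_atTop m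
  filter_upwards [hlarge k, hlarge l] with n hk hl
  have hb0 : (b : ℂ) ^ n ≠ 0 := pow_ne_zero n (Nat.cast_ne_zero.2 (NeZero.ne b))
  rw [sum_walsh_gridDigits_mul_conj hb, Nat.mod_eq_of_lt hk, Nat.mod_eq_of_lt hl, mul_ite,
    mul_zero, inv_mul_cancel₀ hb0]

theorem hasSum_integral_digitMeasure {F : ℕ → (ℕ → Fin b) → ℂ} (hF : ∀ k, Continuous (F k))
    {u : ℕ → ℝ} (hu : Summable u) (hFu : ∀ k d, ‖F k d‖ ≤ u k) :
    HasSum (fun k => ∫ d, F k d ∂digitMeasure b) (∫ d, ∑' k, F k d ∂digitMeasure b) := by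
  refine hasSum_integral_of_summable_integral_norm (fun k => integrable_digitMeasure (hF k))
    (hu.of_nonneg_of_le (fun k => integral_nonneg fun d => norm_nonneg _) fun k => ?_)
  simpa using integral_mono (integrable_digitMeasure (hF k).norm)
    (integrable_const (u k)) (hFu k)

/-- The `k`-th Walsh–Fourier coefficient of a function of digit sequences. -/
noncomputable def walshCoeff (b : ℕ) [NeZero b] (k : ℕ) (G : (ℕ → Fin b) → ℂ) : ℂ :=
  ∫ d, starRingEnd ℂ (walsh b k d) * G d ∂digitMeasure b

theorem walshCoeff_tsum_mul_walsh (hb : 1 < b) {A : ℕ → ℂ} (hA : Summable fun k => ‖A k‖) (l : ℕ) :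
    walshCoeff b l (fun d => ∑' k, A k * walsh b k d) = A l := by
  have hsum := hasSum_integral_digitMeasure (b := b)
    (F := fun k d => A k * (walsh b k d * starRingEnd ℂ (walsh b l d))) (fun k => by fun_prop) hA
    fun k d => by simp [norm_walsh hb]
  simp only [integral_const_mul, integral_walsh_mul_conj hb, mul_ite, mul_one, mul_zero] at hsum
  have hval := (hasSum_single l fun k hk => if_neg hk).unique hsum
  rw [if_pos rfl] at hval
  rw [walshCoeff, hval]
  refine integral_congr_ae (.of_forall fun d => ?_)
  simp only [← tsum_mul_left]
  exact tsum_congr fun k => by ring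

theorem hasSum_norm_sq_integral (hb : 1 < b) {A : ℕ → ℂ} (hA : Summable fun k => ‖A k‖) :
    HasSum (fun k => ‖A k‖ ^ 2) (∫ d, ‖∑' k, A k * walsh b k d‖ ^ 2 ∂digitMeasure b) := by
  have hU := continuous_tsum_mul_walsh hb hA
  set U := fun d => ∑' k, A k * walsh b k d
  obtain ⟨C, hC⟩ := isCompact_univ.exists_bound_of_continuousOn hU.continuousOn
  have hsum := hasSum_integral_digitMeasure (b := b)
    (F := fun k d => A k * walsh b k d * starRingEnd ℂ (U d)) (fun k => by fun_prop)
    (hA.mul_right C) fun k d => by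
      simpa [norm_walsh hb] using mul_le_mul_of_nonneg_left (hC d (Set.mem_univ d)) (norm_nonneg _)
  have hterm : ∀ k, ∫ d, A k * walsh b k d * starRingEnd ℂ (U d) ∂digitMeasure b
      = ((‖A k‖ ^ 2 : ℝ) : ℂ) := fun k => by
    have hconj : ∫ d, walsh b k d * starRingEnd ℂ (U d) ∂digitMeasure b = starRingEnd ℂ (A k) := by
      rw [← walshCoeff_tsum_mul_walsh hb hA k, walshCoeff, ← integral_conj]
      simp only [map_mul, Complex.conj_conj]; rfl
    simp only [mul_assoc]
    rw [integral_const_mul, hconj, Complex.mul_conj']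
    push_cast; rfl
  have hval : ∀ d, ∑' k, A k * walsh b k d * starRingEnd ℂ (U d) = ((‖U d‖ ^ 2 : ℝ) : ℂ) :=
    fun d => by rw [tsum_mul_right, Complex.mul_conj']; push_cast; rfl
  simp only [hterm, hval, integral_complex_ofReal] at hsum
  exact Complex.hasSum_ofReal.1 hsum

theorem sum_walshCoeff_mul_walsh (hb : 1 < b) {G : (ℕ → Fin b) → ℂ} (hG : Continuous G)
    (s : Finset ℕ) (d : ℕ → Fin b) :
    ∑ k ∈ s, walshCoeff b k G * walsh b k d
      = ∫ e, (∑ k ∈ s, walsh b k (d - e)) * G e ∂digitMeasure b := by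
  simp only [Finset.sum_mul, walsh_sub hb, walshCoeff]
  rw [integral_finsetSum _ fun k _ => integrable_digitMeasure (by fun_prop)]
  refine Finset.sum_congr rfl fun k _ => ?_
  rw [← integral_mul_const]
  exact integral_congr_ae (.of_forall fun e => by ring)

theorem integral_sum_walsh_sub (hb : 1 < b) (n : ℕ) (d : ℕ → Fin b) :
    ∫ e, ∑ k ∈ Finset.range (b ^ n), walsh b k (d - e) ∂digitMeasure b = 1 := by
  have hcoeff : ∀ k, walshCoeff b k (fun _ => (1 : ℂ)) = if k = 0 then 1 else 0 := fun k => by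
    simpa [walshCoeff, walsh_zero hb, eq_comm] using integral_walsh_mul_conj (b := b) hb 0 k
  have hpos : 0 < b ^ n := by positivity
  simpa [hcoeff, walsh_zero hb, hpos] using
    (sum_walshCoeff_mul_walsh hb (continuous_const (y := (1 : ℂ))) (Finset.range (b ^ n)) d).symm

theorem integral_norm_sum_walsh_sub (hb : 1 < b) (n : ℕ) (d : ℕ → Fin b) :
    ∫ e, ‖∑ k ∈ Finset.range (b ^ n), walsh b k (d - e)‖ ∂digitMeasure b = 1 := by
  have hnorm : ∀ e, ((‖∑ k ∈ Finset.range (b ^ n), walsh b k (d - e)‖ : ℝ) : ℂ)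
      = ∑ k ∈ Finset.range (b ^ n), walsh b k (d - e) := fun e => by
    rw [sum_walsh hb]
    split_ifs <;> simp
  rw [← Complex.ofReal_inj, ← integral_complex_ofReal]
  simp only [hnorm, integral_sum_walsh_sub hb, Complex.ofReal_one]

theorem tendsto_sum_walshCoeff (hb : 1 < b) {G : (ℕ → Fin b) → ℂ} (hG : Continuous G)
    (d : ℕ → Fin b) :
    Tendsto (fun n => ∑ k ∈ Finset.range (b ^ n), walshCoeff b k G * walsh b k d) atTop
      (𝓝 (G d)) := by
  let D : ℕ → (ℕ → Fin b) → ℂ := fun n e => ∑ k ∈ Finset.range (b ^ n), walsh b k (d - e)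
  have hD : ∀ n, Continuous (D n) := fun n => by fun_prop
  refine Metric.tendsto_nhds.2 fun ε hε => ?_
  filter_upwards [eventually_cylinder_subset
    (hG.continuousAt.preimage_mem_nhds (Metric.ball_mem_nhds (G d) (half_pos hε)))] with n hn
  have hdiff : ∑ k ∈ Finset.range (b ^ n), walshCoeff b k G * walsh b k d - G d
      = ∫ e, D n e * (G e - G d) ∂digitMeasure b := by
    simp only [mul_sub]
    rw [integral_sub (integrable_digitMeasure (by fun_prop))
      (integrable_digitMeasure (by fun_prop)), integral_mul_const, integral_sum_walsh_sub hb,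
      one_mul, sum_walshCoeff_mul_walsh hb hG]
  have hbound : ∀ e, ‖D n e * (G e - G d)‖ ≤ ‖D n e‖ * (ε / 2) := fun e => by
    rw [norm_mul]
    by_cases he : ∀ ℓ < n, (d - e) ℓ = 0
    · have hmem : e ∈ PiNat.cylinder d n :=
        PiNat.mem_cylinder_iff.2 fun ℓ hℓ => (sub_eq_zero.1 (he ℓ hℓ)).symm
      exact mul_le_mul_of_nonneg_left (mem_ball_iff_norm.1 (hn hmem)).le (norm_nonneg _)
    · have hD0 : D n e = 0 := (sum_walsh hb n (d - e)).trans (if_neg he)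
      simp [hD0]
  have hle := norm_integral_le_of_norm_le
    (integrable_digitMeasure (G := fun e => ‖D n e‖ * (ε / 2)) (by fun_prop)) (.of_forall hbound)
  rw [integral_mul_const, integral_norm_sum_walsh_sub hb, one_mul, ← hdiff] at hle
  rw [dist_eq_norm]
  linarith

theorem hasSum_walshCoeff_mul_walsh (hb : 1 < b) {G : (ℕ → Fin b) → ℂ} (hG : Continuous G)
    (hsum : Summable fun k => ‖walshCoeff b k G‖) (d : ℕ → Fin b) :
    HasSum (fun k => walshCoeff b k G * walsh b k d) (G d) := by
  have hS : Summable fun k => walshCoeff b k G * walsh b k d :=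
    .of_norm_bounded hsum fun k => by rw [norm_mul, norm_walsh hb, mul_one]
  have hlim := hS.hasSum.tendsto_sum_nat.comp (tendsto_pow_atTop_atTop_of_one_lt hb)
  exact tendsto_nhds_unique hlim (tendsto_sum_walshCoeff hb hG d) ▸ hS.hasSum

end DigitMeasure

/-! ### Discrete Walsh coefficients on shifted grids -/

section GridWalshCoeff

open MeasureTheory Filter Topology

variable {b : ℕ}

theorem norm_conj_rootOfUnity_pow_mul (hb : 1 < b) (m : ℕ) (z : ℂ) :
    ‖starRingEnd ℂ (rootOfUnity b ^ m) * z‖ = ‖z‖ := by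
  rw [norm_mul, Complex.norm_conj, norm_pow, norm_rootOfUnity hb, one_pow, one_mul]

theorem leading_digit_ne_zero (hb : 1 < b) {k : ℕ} (hk : k ≠ 0) : k / b ^ Nat.log b k % b ≠ 0 := by
  have hpos : 0 < k / b ^ Nat.log b k := Nat.div_pos (Nat.pow_log_le_self b hk) (by positivity)
  have hlt : k / b ^ Nat.log b k < b :=
    Nat.div_lt_of_lt_mul (by rw [← pow_succ]; exact Nat.lt_pow_succ_log_self hb k)
  rw [Nat.mod_eq_of_lt hlt]
  exact hpos.ne'

theorem dropLead_lt (hb : 1 < b) (k : ℕ) : dropLead b k < b ^ Nat.log b k :=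
  Nat.mod_lt _ (by positivity)

theorem mu_index_zero (b m : ℕ) : mu b m 0 = 0 := by
  cases m <;> simp [mu]

variable [NeZero b]

/-- The `k`-th discrete Walsh coefficient of `F`, from its values on the grid of mesh `b ^ (-n)`
shifted by `x`. Shifts in `[0, b ^ (-n)]` are what refining the grid produces. -/
noncomputable def gridWalshCoeff (b : ℕ) [NeZero b] (k : ℕ) (F : ℝ → ℝ) (n : ℕ) (x : ℝ) : ℂ :=
  ((b : ℂ) ^ n)⁻¹ * ∑ j ∈ Finset.range (b ^ n),
    starRingEnd ℂ (walsh b k (gridDigits b n j)) * (F (x + j * ((b : ℝ) ^ n)⁻¹) : ℂ)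

theorem gridWalshCoeff_succ (hb : 1 < b) (k : ℕ) (F : ℝ → ℝ) (n : ℕ) (x : ℝ) :
    gridWalshCoeff b k F (n + 1) x = (b : ℂ)⁻¹ * ∑ d ∈ Finset.range b,
      starRingEnd ℂ (rootOfUnity b ^ ((k / b ^ n % b) * d)) *
        gridWalshCoeff b k F n (x + d * ((b : ℝ) ^ (n + 1))⁻¹) := by
  have : (b : ℝ) ≠ 0 := Nat.cast_ne_zero.2 (NeZero.ne b)
  have hpoint : ∀ j d : ℕ, x + ((j * b + d : ℕ) : ℝ) * ((b : ℝ) ^ (n + 1))⁻¹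
      = x + d * ((b : ℝ) ^ (n + 1))⁻¹ + j * ((b : ℝ) ^ n)⁻¹ := fun j d => by
    push_cast
    field_simp
    ring
  simp only [gridWalshCoeff]
  rw [pow_succ b n, sum_range_mul, Finset.sum_comm, pow_succ, mul_inv_rev, mul_assoc]
  simp only [Finset.mul_sum]
  refine Finset.sum_congr rfl fun d hd => Finset.sum_congr rfl fun j _ => ?_
  rw [walsh_gridDigits_succ hb k n j (Finset.mem_range.1 hd), hpoint, map_mul]
  ring

theorem gridWalshCoeff_mod (hb : 1 < b) (k : ℕ) (F : ℝ → ℝ) (n : ℕ) :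
    gridWalshCoeff b (k % b ^ n) F n = gridWalshCoeff b k F n := by
  have hwalsh : ∀ j, walsh b (k % b ^ n) (gridDigits b n j) = walsh b k (gridDigits b n j) := by
    intro j
    have hpos : 0 < b ^ n := by positivity
    have hlt : k < b ^ (n + k) :=
      (Nat.lt_pow_self hb).trans_le (Nat.pow_le_pow_right hb.le (Nat.le_add_left k n))
    rw [walsh_eq_prod hb ((Nat.mod_le k _).trans_lt hlt), walsh_eq_prod hb hlt]
    refine Finset.prod_congr rfl fun ℓ _ => ?_
    rcases lt_or_ge ℓ n with hℓ | hℓ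
    · obtain ⟨m, rfl⟩ := Nat.exists_eq_add_of_lt hℓ
      rw [show b ^ (ℓ + m + 1) = b ^ ℓ * (b * b ^ m) by ring, Nat.mod_mul_right_div_self,
        Nat.mod_mul_right_mod]
    · simp [gridDigits_of_le hℓ]
  ext x
  simp only [gridWalshCoeff, hwalsh]

theorem gridWalshCoeff_sub (k : ℕ) (F G : ℝ → ℝ) (n : ℕ) (x : ℝ) :
    gridWalshCoeff b k (F - G) n x = gridWalshCoeff b k F n x - gridWalshCoeff b k G n x := by
  simp only [gridWalshCoeff, Pi.sub_apply, Complex.ofReal_sub, mul_sub, Finset.sum_sub_distrib]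

theorem continuous_gridWalshCoeff (k : ℕ) {F : ℝ → ℝ} (hF : Continuous F) (n : ℕ) :
    Continuous (gridWalshCoeff b k F n) := by
  unfold gridWalshCoeff
  fun_prop

theorem hasDerivWithinAt_comp_add_const {F : ℝ → ℝ} {F' c x : ℝ}
    (hF : HasDerivWithinAt F F' (Set.Ici (x + c)) (x + c)) :
    HasDerivWithinAt (fun y => F (y + c)) F' (Set.Ici x) x := by
  have h := hF.scomp x ((hasDerivWithinAt_id x (Set.Ici x)).add_const c) fun y hy => by
    simpa using hy
  rwa [one_smul] at h

theorem hasDerivWithinAt_gridWalshCoeff (k : ℕ) {F F' : ℝ → ℝ}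
    (hF : ∀ x, HasDerivWithinAt F (F' x) (Set.Ici x) x) (n : ℕ) (x : ℝ) :
    HasDerivWithinAt (gridWalshCoeff b k F n) (gridWalshCoeff b k F' n x) (Set.Ici x) x :=
  .const_mul _ <| .fun_sum fun _ _ => .const_mul _ <|
    (hasDerivWithinAt_comp_add_const (hF _)).ofReal_comp

theorem norm_gridWalshCoeff_le_sum (hb : 1 < b) (k : ℕ) (F : ℝ → ℝ) (n : ℕ) (x : ℝ) :
    ‖gridWalshCoeff b k F n x‖
      ≤ ((b : ℝ) ^ n)⁻¹ * ∑ j ∈ Finset.range (b ^ n), |F (x + j * ((b : ℝ) ^ n)⁻¹)| := by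
  rw [gridWalshCoeff, norm_mul, norm_inv, norm_pow, Complex.norm_natCast]
  gcongr
  refine (norm_sum_le _ _).trans_eq (Finset.sum_congr rfl fun j _ => ?_)
  rw [norm_mul, Complex.norm_conj, norm_walsh hb, one_mul, Complex.norm_real, Real.norm_eq_abs]

theorem gridWalshCoeff_comp_add_const (k : ℕ) (F : ℝ → ℝ) (δ : ℝ) (n : ℕ) (x : ℝ) :
    gridWalshCoeff b k (fun y => F (y + δ)) n x = gridWalshCoeff b k F n (x + δ) := by
  simp only [gridWalshCoeff, add_right_comm x _ δ]

theorem norm_inv_mul_sum_range_le {N : ℕ} (hN : N ≠ 0) {f : ℕ → ℂ} {B : ℝ}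
    (hf : ∀ i < N, ‖f i‖ ≤ B) : ‖(N : ℂ)⁻¹ * ∑ i ∈ Finset.range N, f i‖ ≤ B := by
  have hN0 : (0 : ℝ) < N := by positivity
  have hsum : ‖∑ i ∈ Finset.range N, f i‖ ≤ N * B := by
    simpa using norm_sum_le_of_le (Finset.range N) fun i hi => hf i (Finset.mem_range.1 hi)
  rwa [norm_mul, norm_inv, Complex.norm_natCast, inv_mul_le_iff₀ hN0]

theorem add_mul_mem_Icc {x h : ℝ} (hx : x ∈ Set.Icc 0 h) {j m : ℕ} (hj : j < m) :
    x + j * h ∈ Set.Icc 0 (m * h) := by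
  have hh : 0 ≤ h := hx.1.trans hx.2
  have hjm : (j : ℝ) + 1 ≤ m := by exact_mod_cast hj
  exact ⟨add_nonneg hx.1 (by positivity), by nlinarith [hx.2]⟩

theorem natCast_mul_inv_pow_succ (n : ℕ) : (b : ℝ) * ((b : ℝ) ^ (n + 1))⁻¹ = ((b : ℝ) ^ n)⁻¹ := by
  have hb0 : (b : ℝ) ≠ 0 := Nat.cast_ne_zero.2 (NeZero.ne b)
  rw [pow_succ, mul_inv_rev, mul_inv_cancel_left₀ hb0]

theorem norm_gridWalshCoeff_le (hb : 1 < b) {F : ℝ → ℝ} {M : ℝ}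
    (hF : ∀ y ∈ Set.Icc (0 : ℝ) 1, |F y| ≤ M) {n : ℕ} (k : ℕ) {x : ℝ}
    (hx : x ∈ Set.Icc 0 ((b : ℝ) ^ n)⁻¹) : ‖gridWalshCoeff b k F n x‖ ≤ M := by
  have hpow : ((b ^ n : ℕ) : ℝ) * ((b : ℝ) ^ n)⁻¹ = 1 := by
    rw [Nat.cast_pow, mul_inv_cancel₀ (by positivity)]
  rw [gridWalshCoeff, ← Nat.cast_pow]
  refine norm_inv_mul_sum_range_le (by positivity) fun j hj => ?_
  rw [norm_mul, Complex.norm_conj, norm_walsh hb, one_mul, Complex.norm_real, Real.norm_eq_abs]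
  exact hF _ (hpow ▸ add_mul_mem_Icc hx hj)

theorem norm_gridWalshCoeff_le_of_le (hb : 1 < b) (k : ℕ) (F : ℝ → ℝ) {B : ℝ} {m n : ℕ}
    (hmn : m ≤ n) (h : ∀ x ∈ Set.Icc 0 ((b : ℝ) ^ m)⁻¹, ‖gridWalshCoeff b k F m x‖ ≤ B) :
    ∀ x ∈ Set.Icc 0 ((b : ℝ) ^ n)⁻¹, ‖gridWalshCoeff b k F n x‖ ≤ B := by
  induction n, hmn using Nat.le_induction with
  | base => exact h
  | succ n _ ih =>
    intro x hx
    rw [gridWalshCoeff_succ hb]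
    refine norm_inv_mul_sum_range_le (by omega) fun d hd => ?_
    rw [norm_conj_rootOfUnity_pow_mul hb]
    exact ih _ (natCast_mul_inv_pow_succ (b := b) n ▸ add_mul_mem_Icc hx hd)

/-- A nonzero digit of index `n` makes the mean over the last refinement cancel constants, so only
the increments of the coarser coefficient matter. -/
theorem norm_gridWalshCoeff_succ_le (hb : 1 < b) {k n : ℕ} (hk : k / b ^ n % b ≠ 0) (F : ℝ → ℝ)
    {x B : ℝ} (h : ∀ d < b, ‖gridWalshCoeff b k F n (x + d * ((b : ℝ) ^ (n + 1))⁻¹)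
      - gridWalshCoeff b k F n x‖ ≤ B) : ‖gridWalshCoeff b k F (n + 1) x‖ ≤ B := by
  have hcancel :
      ∑ d ∈ Finset.range b, starRingEnd ℂ (rootOfUnity b ^ ((k / b ^ n % b) * d)) = 0 := by
    simpa [hk.symm] using sum_rootOfUnity_mul_conj hb (d := 0) (by omega)
      (Nat.mod_lt (k / b ^ n) (by omega))
  have hdiff : gridWalshCoeff b k F (n + 1) x = (b : ℂ)⁻¹ * ∑ d ∈ Finset.range b,
      starRingEnd ℂ (rootOfUnity b ^ ((k / b ^ n % b) * d)) *
        (gridWalshCoeff b k F n (x + d * ((b : ℝ) ^ (n + 1))⁻¹) - gridWalshCoeff b k F n x) := by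
    simp_rw [mul_sub]
    rw [Finset.sum_sub_distrib, ← Finset.sum_mul, hcancel, zero_mul, sub_zero,
      gridWalshCoeff_succ hb]
  rw [hdiff]
  refine norm_inv_mul_sum_range_le (by omega) fun d hd => ?_
  rw [norm_conj_rootOfUnity_pow_mul hb]
  exact h d hd

theorem norm_gridWalshCoeff_le_of_increments (hb : 1 < b) {k : ℕ} (hk : k ≠ 0) (F : ℝ → ℝ) {B : ℝ}
    (h : ∀ x δ, 0 ≤ x → 0 ≤ δ → x + δ ≤ ((b : ℝ) ^ Nat.log b k)⁻¹ →
      ‖gridWalshCoeff b k F (Nat.log b k) (x + δ) - gridWalshCoeff b k F (Nat.log b k) x‖ ≤ B)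
    {n : ℕ} (hkn : k < b ^ n) :
    ∀ x ∈ Set.Icc 0 ((b : ℝ) ^ n)⁻¹, ‖gridWalshCoeff b k F n x‖ ≤ B := by
  refine norm_gridWalshCoeff_le_of_le hb k F (Nat.log_lt_of_lt_pow hk hkn) fun x hx => ?_
  refine norm_gridWalshCoeff_succ_le hb (leading_digit_ne_zero hb hk) F fun d hd => ?_
  refine h x _ hx.1 (by positivity) ?_
  exact (natCast_mul_inv_pow_succ (b := b) (Nat.log b k) ▸ add_mul_mem_Icc hx hd).2

theorem norm_gridWalshCoeff_add_sub_le_of_monotone (hb : 1 < b) (k : ℕ) {g : ℝ → ℝ}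
    (hg : Monotone g) {n : ℕ} {x δ : ℝ} (hδ : 0 ≤ δ) (hδn : δ ≤ ((b : ℝ) ^ n)⁻¹) :
    ‖gridWalshCoeff b k g n (x + δ) - gridWalshCoeff b k g n x‖
      ≤ ((b : ℝ) ^ n)⁻¹ * (g (x + 1) - g x) := by
  set h := ((b : ℝ) ^ n)⁻¹ with hh
  have hpow : ((b ^ n : ℕ) : ℝ) * h = 1 := by
    rw [Nat.cast_pow, hh, mul_inv_cancel₀ (by positivity)]
  rw [← gridWalshCoeff_comp_add_const, ← gridWalshCoeff_sub]
  refine (norm_gridWalshCoeff_le_sum hb _ _ _ _).trans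
    (mul_le_mul_of_nonneg_left ?_ (by positivity))
  calc ∑ j ∈ Finset.range (b ^ n), |((fun y => g (y + δ)) - g) (x + j * h)|
      ≤ ∑ j ∈ Finset.range (b ^ n), (g (x + (j + 1 : ℕ) * h) - g (x + j * h)) := by
        refine Finset.sum_le_sum fun j _ => ?_
        rw [Pi.sub_apply, abs_of_nonneg (sub_nonneg.2 (hg (by linarith)))]
        refine sub_le_sub_right (hg ?_) _
        push_cast
        linarith
    _ = g (x + 1) - g x := by
        rw [Finset.sum_range_sub fun j : ℕ => g (x + j * h), hpow, Nat.cast_zero, zero_mul,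
          add_zero]

theorem norm_gridWalshCoeff_le_of_monotone (hb : 1 < b) {k : ℕ} (hk : k ≠ 0) {g : ℝ → ℝ}
    (hg : Monotone g) {C : ℝ} (hgC : ∀ x, g (x + 1) - g x ≤ C) {n : ℕ} (hkn : k < b ^ n) :
    ∀ x ∈ Set.Icc 0 ((b : ℝ) ^ n)⁻¹,
      ‖gridWalshCoeff b k g n x‖ ≤ ((b : ℝ) ^ Nat.log b k)⁻¹ * C :=
  norm_gridWalshCoeff_le_of_increments hb hk g (hkn := hkn) fun _ _ hx hδ hxδ =>
    (norm_gridWalshCoeff_add_sub_le_of_monotone hb k hg hδ (by linarith)).trans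
      (mul_le_mul_of_nonneg_left (hgC _) (by positivity))

/-- The discrete Walsh coefficients of `F` are bounded by `M b ^ (-μ_m(k))` on all grids which
resolve `k`. -/
def WalshDecay (b : ℕ) [NeZero b] (m : ℕ) (M : ℝ) (F : ℝ → ℝ) : Prop :=
  ∀ n k, k < b ^ n → ∀ x ∈ Set.Icc 0 ((b : ℝ) ^ n)⁻¹,
    ‖gridWalshCoeff b k F n x‖ ≤ M * ((b : ℝ) ^ mu b m k)⁻¹

theorem WalshDecay.mono {m : ℕ} {M N : ℝ} {F : ℝ → ℝ} (h : WalshDecay b m M F) (hMN : M ≤ N) :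
    WalshDecay b m N F := fun n k hk x hx =>
  (h n k hk x hx).trans (mul_le_mul_of_nonneg_right hMN (by positivity))

theorem WalshDecay.of_bounded (hb : 1 < b) {M : ℝ} {F : ℝ → ℝ}
    (hF : ∀ y ∈ Set.Icc (0 : ℝ) 1, |F y| ≤ M) : WalshDecay b 0 M F := by
  intro n k _ x hx
  simpa [mu] using norm_gridWalshCoeff_le hb hF k hx

/-- The leading digit `κ b ^ a` of `k` gains the factor `b ^ (-a)` by the mean value inequality on
an interval of that length, and leaves the coefficient of `F'` at the truncated index. -/
theorem WalshDecay.of_hasDerivWithinAt {m : ℕ} (hb : 1 < b) {M : ℝ} {F F' : ℝ → ℝ}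
    (hcont : Continuous F) (hderiv : ∀ x, HasDerivWithinAt F (F' x) (Set.Ici x) x)
    (hbound : ∀ y ∈ Set.Icc (0 : ℝ) 1, |F y| ≤ M) (hF' : WalshDecay b m M F') :
    WalshDecay b (m + 1) (M * b) F := by
  have hM : 0 ≤ M := (abs_nonneg _).trans (hbound 0 (by simp))
  intro n k hkn
  by_cases hk : k = 0
  · intro x hx
    rw [hk, mu_index_zero, pow_zero, inv_one, mul_one]
    exact (norm_gridWalshCoeff_le hb hbound 0 hx).trans
      (le_mul_of_one_le_right hM (by exact_mod_cast hb.le))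
  refine norm_gridWalshCoeff_le_of_increments hb hk F (hkn := hkn) fun x δ hx hδ hxδ => ?_
  rw [← gridWalshCoeff_mod hb k, ← dropLead, mu, if_neg hk]
  set a := Nat.log b k
  have hmean := norm_image_sub_le_of_norm_deriv_right_le_segment
    (continuous_gridWalshCoeff (b := b) (dropLead b k) hcont a).continuousOn
    (fun y _ => hasDerivWithinAt_gridWalshCoeff (dropLead b k) hderiv a y)
    (fun y hy => hF' a _ (dropLead_lt hb k) y ⟨hx.trans hy.1, hy.2.le.trans hxδ⟩)
    (x + δ) ⟨le_add_of_nonneg_right hδ, le_rfl⟩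
  calc _ ≤ M * ((b : ℝ) ^ mu b m (dropLead b k))⁻¹ * δ := by rwa [add_sub_cancel_left] at hmean
    _ ≤ M * ((b : ℝ) ^ mu b m (dropLead b k))⁻¹ * ((b : ℝ) ^ a)⁻¹ := by
        gcongr
        linarith
    _ = M * b * ((b : ℝ) ^ (a + 1 + mu b m (dropLead b k)))⁻¹ := by
        have : (b : ℝ) ≠ 0 := Nat.cast_ne_zero.2 (NeZero.ne b)
        field_simp
        ring

theorem ofDigits_gridDigits (hb : 1 < b) {n j : ℕ} (hj : j < b ^ n) :
    Real.ofDigits (gridDigits b n j) = j * ((b : ℝ) ^ n)⁻¹ := by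
  have hlt : (j : ℝ) / (b : ℝ) ^ n < 1 := by
    rw [div_lt_one (by positivity)]
    exact_mod_cast hj
  rw [gridDigits, Real.ofDigits_digits hb ⟨by positivity, hlt⟩, div_eq_mul_inv]

theorem tendsto_gridWalshCoeff (hb : 1 < b) (k : ℕ) {F : ℝ → ℝ} (hF : Continuous F) :
    Tendsto (fun n => gridWalshCoeff b k F n 0) atTop
      (𝓝 (walshCoeff b k fun d => (F (Real.ofDigits d) : ℂ))) := by
  have hcont : Continuous fun d : ℕ → Fin b => (F (Real.ofDigits d) : ℂ) :=
    Complex.continuous_ofReal.comp (hF.comp Real.continuous_ofDigits)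
  refine (tendsto_mean_gridDigits (by fun_prop)).congr fun n => ?_
  refine congrArg _ (Finset.sum_congr rfl fun j hj => ?_)
  beta_reduce
  rw [ofDigits_gridDigits hb (Finset.mem_range.1 hj), zero_add]

theorem WalshDecay.norm_walshCoeff_le (hb : 1 < b) {m : ℕ} {M : ℝ} {F : ℝ → ℝ}
    (h : WalshDecay b m M F) (hF : Continuous F) (k : ℕ) :
    ‖walshCoeff b k fun d => (F (Real.ofDigits d) : ℂ)‖ ≤ M * ((b : ℝ) ^ mu b m k)⁻¹ := by
  refine le_of_tendsto (tendsto_gridWalshCoeff hb k hF).norm ?_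
  filter_upwards [eventually_ge_atTop k] with n hn
  exact h n k (hn.trans_lt (Nat.lt_pow_self hb)) 0 ⟨le_rfl, by positivity⟩

end GridWalshCoeff

/-! ### Bernoulli functions and the Sobolev kernel -/

section Bernoulli

open MeasureTheory

/-- The normalised Bernoulli polynomial `B_m / m!`, for which differentiation lowers the index. -/
noncomputable def bern (m : ℕ) (x : ℝ) : ℝ := bernoulliFun m x / (m ! : ℕ)

/-- The `1`-periodic extension of `B_m / m!` from `[0,1)`. -/
noncomputable def perBern (m : ℕ) (x : ℝ) : ℝ := bern m (Int.fract x)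

@[fun_prop]
theorem continuous_bern (m : ℕ) : Continuous (bern m) :=
  (continuous_bernoulliFun m).div_const _

theorem hasDerivAt_bern (m : ℕ) (x : ℝ) : HasDerivAt (bern (m + 1)) (bern m x) x := by
  refine ((hasDerivAt_bernoulliFun (m + 1) x).div_const _).congr_deriv ?_
  rw [Nat.add_sub_cancel, Nat.factorial_succ, Nat.cast_mul,
    mul_div_mul_left _ _ (by positivity), bern]

theorem bern_zero : bern 0 = 1 := by
  ext
  simp [bern]

theorem bern_one (x : ℝ) : bern 1 x = x - 1 / 2 := by simp [bern]

theorem bern_endpoints {m : ℕ} (hm : m ≠ 1) : bern m 1 = bern m 0 := by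
  rw [bern, bern, bernoulliFun_endpoints_eq_of_ne_one hm]

theorem integral_bern {m : ℕ} (hm : m ≠ 0) : ∫ x in (0 : ℝ)..1, bern m x = 0 := by
  simp only [bern]
  rw [intervalIntegral.integral_div, integral_bernoulliFun_eq_zero hm, zero_div]

theorem periodic_perBern (m : ℕ) : Function.Periodic (perBern m) 1 := fun x => by
  rw [perBern, Int.fract_add_one, perBern]

theorem continuous_perBern {m : ℕ} (hm : m ≠ 1) : Continuous (perBern m) :=
  ContinuousOn.comp_fract'' (continuous_bern m).continuousOn (bern_endpoints hm).symm

theorem eqOn_perBern_bern (m : ℕ) : Set.EqOn (perBern m) (bern m) (Set.Ico 0 1) := fun x hx => by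
  rw [perBern, Int.fract_eq_self.2 hx]

theorem hasDerivWithinAt_perBern (m : ℕ) (x : ℝ) :
    HasDerivWithinAt (perBern (m + 1)) (perBern m x) (Set.Ici x) x := by
  have hbern : HasDerivWithinAt (fun y : ℝ => bern (m + 1) (y - ⌊x⌋)) (perBern m x) (Set.Ici x) x :=
    ((hasDerivAt_bern m (x - ⌊x⌋)).comp_sub_const x ⌊x⌋).hasDerivWithinAt
  refine hbern.congr_of_eventuallyEq ?_ rfl
  filter_upwards [Ico_mem_nhdsGE (Int.lt_floor_add_one x)] with y hy
  rw [perBern, Int.fract, Int.floor_eq_iff.2 ⟨(Int.floor_le x).trans hy.1, hy.2⟩]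

theorem exists_abs_bern_le (m : ℕ) : ∃ M, ∀ x ∈ Set.Icc (0 : ℝ) 1, |bern m x| ≤ M :=
  isCompact_Icc.exists_bound_of_continuousOn (continuous_bern m).continuousOn

theorem exists_abs_perBern_le (m : ℕ) : ∃ M, ∀ x, |perBern m x| ≤ M := by
  obtain ⟨M, hM⟩ := exists_abs_bern_le m
  exact ⟨M, fun x => hM _ ⟨Int.fract_nonneg x, (Int.fract_lt_one x).le⟩⟩

theorem intervalIntegrable_perBern_add (m : ℕ) (c u v : ℝ) :
    IntervalIntegrable (fun s => perBern m (s + c)) volume u v := by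
  obtain ⟨M, hM⟩ := exists_abs_perBern_le m
  have hmeas : Measurable (perBern m) := (continuous_bern m).measurable.comp measurable_fract
  have hconst : IntervalIntegrable (fun _ : ℝ => M) volume u v := intervalIntegrable_const
  exact hconst.mono_fun'
    (hmeas.comp (measurable_id.add_const c)).aestronglyMeasurable (.of_forall fun s => hM _)

theorem integral_comp_add_of_periodic {f : ℝ → ℝ} (hf : Function.Periodic f 1)
    (c : ℝ) : ∫ s in (0 : ℝ)..1, f (s + c) = ∫ s in (0 : ℝ)..1, f s := by
  rw [intervalIntegral.integral_comp_add_right, zero_add, add_comm 1 c,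
    hf.intervalIntegral_add_eq c 0, zero_add]

theorem integral_perBern_add {m : ℕ} (hm : m ≠ 0) (c : ℝ) :
    ∫ s in (0 : ℝ)..1, perBern m (s + c) = 0 := by
  rw [integral_comp_add_of_periodic (periodic_perBern m),
    intervalIntegral.integral_congr_Ioo_of_le (g := bern m) zero_le_one
      ((eqOn_perBern_bern m).mono Set.Ioo_subset_Ico_self), integral_bern hm]

theorem integral_bern_succ_mul_perBern_succ (m n : ℕ) (c : ℝ) :
    ∫ s in (0 : ℝ)..1, bern (m + 1) s * perBern (n + 1) (s + c)
      = (bern (m + 1) 1 - bern (m + 1) 0) * perBern (n + 2) c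
        - ∫ s in (0 : ℝ)..1, bern m s * perBern (n + 2) (s + c) := by
  have hcont : Continuous fun s => perBern (n + 2) (s + c) :=
    (continuous_perBern (by omega)).comp (by fun_prop)
  rw [intervalIntegral.integral_mul_deriv_eq_deriv_mul_of_hasDeriv_right
    (continuous_bern (m + 1)).continuousOn hcont.continuousOn
    (fun x _ => (hasDerivAt_bern m x).hasDerivWithinAt)
    (fun x _ => (hasDerivWithinAt_comp_add_const (hasDerivWithinAt_perBern (n + 1) _)).mono
      Set.Ioi_subset_Ici_self)
    ((continuous_bern m).intervalIntegrable _ _) (intervalIntegrable_perBern_add (n + 1) c _ _),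
    add_comm 1 c, periodic_perBern, zero_add, sub_mul]

theorem integral_bern_mul_perBern (m n : ℕ) (c : ℝ) :
    ∫ s in (0 : ℝ)..1, bern (m + 1) s * perBern (n + 1) (s + c)
      = (-1) ^ m * perBern (m + n + 2) c := by
  induction m generalizing n with
  | zero =>
    rw [integral_bern_succ_mul_perBern_succ]
    simp only [bern_zero, Pi.one_apply, one_mul, zero_add, bern_one]
    rw [integral_perBern_add (by omega)]
    ring
  | succ m ih =>
    rw [integral_bern_succ_mul_perBern_succ, bern_endpoints (by omega), sub_self, zero_mul,
      zero_sub, ih (n + 1), pow_succ, show m + 1 + n + 2 = m + (n + 1) + 2 by ring]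
    ring

theorem integral_perBern_mul_perBern {α : ℕ} (hα : α ≠ 0) (x y : ℝ) :
    ∫ s in (0 : ℝ)..1, perBern α (x + s) * perBern α (y + s)
      = (-1) ^ (α + 1) * perBern (2 * α) (x - y) := by
  obtain ⟨m, rfl⟩ := Nat.exists_eq_succ_of_ne_zero hα
  set f := fun s => perBern (m + 1) s * perBern (m + 1) (s + (x - y)) with hf
  have hper : Function.Periodic f 1 := fun s => by
    simp only [hf, add_right_comm s 1, periodic_perBern (m + 1) _]
  calc ∫ s in (0 : ℝ)..1, perBern (m + 1) (x + s) * perBern (m + 1) (y + s)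
      = ∫ s in (0 : ℝ)..1, f (s + y) := by
        congr 1
        ext s
        rw [hf, mul_comm, add_comm y s, show x + s = s + y + (x - y) by ring]
    _ = ∫ s in (0 : ℝ)..1, f s := integral_comp_add_of_periodic hper y
    _ = ∫ s in (0 : ℝ)..1, bern (m + 1) s * perBern (m + 1) (s + (x - y)) :=
        intervalIntegral.integral_congr_Ioo_of_le zero_le_one fun s hs => by
          simp only [hf]
          rw [eqOn_perBern_bern _ (Set.Ioo_subset_Ico_self hs)]
    _ = (-1) ^ (m + 1 + 1) * perBern (2 * (m + 1)) (x - y) := by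
        rw [integral_bern_mul_perBern, show 2 * (m + 1) = m + m + 2 by ring]
        ring

theorem sobolevKernel_eq_sum_add_perBern (α : ℕ) (x y : ℝ) :
    sobolevKernel α x y = ∑ l ∈ Finset.Icc 1 α, bern l x * bern l y
      + (-1) ^ (α + 1) * perBern (2 * α) (x - y) := by
  simp only [sobolevKernel, perBern, bern, div_mul_div_comm, sq]
  ring

theorem sobolevKernel_eq_sum_add_integral {α : ℕ} (hα : α ≠ 0) (x y : ℝ) :
    sobolevKernel α x y = ∑ l ∈ Finset.Icc 1 α, bern l x * bern l y
      + ∫ s in (0 : ℝ)..1, perBern α (x + s) * perBern α (y + s) := by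
  rw [sobolevKernel_eq_sum_add_perBern, integral_perBern_mul_perBern hα]

theorem continuous_sobolevKernel (α : ℕ) :
    Continuous fun p : ℝ × ℝ => sobolevKernel α p.1 p.2 := by
  have hper : Continuous (perBern (2 * α)) := continuous_perBern (by omega)
  simp_rw [sobolevKernel_eq_sum_add_perBern]
  fun_prop

theorem quadForm_mul {X : Type} (f : X → ℝ) (s : Finset X) (c : X → ℝ) :
    quadForm (fun x y => f x * f y) s c = (∑ x ∈ s, c x * f x) ^ 2 := by
  rw [quadForm, sq, Finset.sum_mul_sum]
  exact Finset.sum_congr rfl fun x _ => Finset.sum_congr rfl fun y _ => mul_mul_mul_comm _ _ _ _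

theorem quadForm_sobolevKernel {X : Type} {α : ℕ} (hα : 2 ≤ α) (p : X → ℝ) (s : Finset X)
    (c : X → ℝ) :
    quadForm (fun x y => sobolevKernel α (p x) (p y)) s c
      = ∑ l ∈ Finset.Icc 1 α, (∑ x ∈ s, c x * bern l (p x)) ^ 2
        + ∫ t in (0 : ℝ)..1, (∑ x ∈ s, c x * perBern α (p x + t)) ^ 2 := by
  have hper : Continuous (perBern α) := continuous_perBern (by omega)
  simp only [← quadForm_mul, quadForm]
  rw [intervalIntegral.integral_finsetSum fun _ _ =>
      Continuous.intervalIntegrable (by fun_prop) _ _,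
    Finset.sum_comm (s := Finset.Icc 1 α), ← Finset.sum_add_distrib]
  refine Finset.sum_congr rfl fun x _ => ?_
  rw [intervalIntegral.integral_finsetSum fun _ _ =>
      Continuous.intervalIntegrable (by fun_prop) _ _,
    Finset.sum_comm (s := Finset.Icc 1 α), ← Finset.sum_add_distrib]
  refine Finset.sum_congr rfl fun y _ => ?_
  rw [sobolevKernel_eq_sum_add_integral (by omega), mul_add, Finset.mul_sum,
    intervalIntegral.integral_const_mul]

end Bernoulli

/-! ### The features of the Sobolev kernel -/

section Feature

open MeasureTheory

variable {b : ℕ} [NeZero b]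

theorem exists_walshDecay_bern (hb : 1 < b) (m l : ℕ) : ∃ M, WalshDecay b m M (bern l) := by
  induction m generalizing l with
  | zero =>
    obtain ⟨M, hM⟩ := exists_abs_bern_le l
    exact ⟨M, .of_bounded hb hM⟩
  | succ m ih =>
    obtain ⟨M, hM⟩ := exists_abs_bern_le l
    obtain ⟨F', N, hderiv, hN⟩ : ∃ (F' : ℝ → ℝ) (N : ℝ),
        (∀ x, HasDerivAt (bern l) (F' x) x) ∧ WalshDecay b m N F' := by
      rcases l with _ | l
      · refine ⟨0, 0, fun x => bern_zero ▸ hasDerivAt_const x 1, fun n k _ x _ => ?_⟩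
        simp [gridWalshCoeff]
      · exact (ih l).elim fun N hN => ⟨bern l, N, hasDerivAt_bern l, hN⟩
    exact ⟨max M N * b, .of_hasDerivWithinAt hb (continuous_bern l)
      (fun x => (hderiv x).hasDerivWithinAt) (fun y hy => (hM y hy).trans (le_max_left _ _))
      (hN.mono (le_max_right _ _))⟩

theorem perBern_one_add_eq_sub (s : ℝ) : (fun x => perBern 1 (x + s))
    = (fun x => x + s - 1 / 2) - fun x => (⌊x + s⌋ : ℝ) := by
  ext x
  rw [perBern, bern_one, Pi.sub_apply, Int.fract]
  ring

theorem walshDecay_perBern_one (hb : 1 < b) (s : ℝ) :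
    WalshDecay b 1 (2 * b) fun x => perBern 1 (x + s) := by
  have hb1 : (1 : ℝ) < b := by exact_mod_cast hb
  intro n k hkn x hx
  by_cases hk : k = 0
  · rw [hk, mu_index_zero, pow_zero, inv_one, mul_one]
    refine norm_gridWalshCoeff_le hb (fun y _ => ?_) 0 hx
    rw [perBern, bern_one, abs_le]
    constructor <;> linarith [Int.fract_nonneg (y + s), Int.fract_lt_one (y + s)]
  have hlin := norm_gridWalshCoeff_le_of_monotone hb hk (g := fun y : ℝ => y + s - 1 / 2) (C := 1)
    (fun y z hyz => by simpa using hyz) (fun y => by linarith) hkn x hx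
  have hfloor := norm_gridWalshCoeff_le_of_monotone hb hk (g := fun y : ℝ => (⌊y + s⌋ : ℝ)) (C := 1)
    (fun y z hyz => Int.cast_le.2 (Int.floor_le_floor (by linarith)))
    (fun y => by simp [add_right_comm y 1 s]) hkn x hx
  rw [perBern_one_add_eq_sub, gridWalshCoeff_sub]
  calc _ ≤ ((b : ℝ) ^ Nat.log b k)⁻¹ * 1 + ((b : ℝ) ^ Nat.log b k)⁻¹ * 1 :=
        (norm_sub_le _ _).trans (add_le_add hlin hfloor)
    _ = 2 * b * ((b : ℝ) ^ mu b 1 k)⁻¹ := by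
        rw [mu, if_neg hk, mu, add_zero, pow_succ]
        field_simp
        norm_num

theorem exists_walshDecay_perBern (hb : 1 < b) {m : ℕ} (hm : 1 ≤ m) :
    ∃ M, ∀ s, WalshDecay b m M fun x => perBern m (x + s) := by
  induction m, hm using Nat.le_induction with
  | base => exact ⟨2 * b, walshDecay_perBern_one hb⟩
  | succ m hm ih =>
    obtain ⟨M, hM⟩ := exists_abs_perBern_le (m + 1)
    obtain ⟨N, hN⟩ := ih
    exact ⟨max M N * b, fun s => .of_hasDerivWithinAt hb
      ((continuous_perBern (by omega)).comp (continuous_add_const s))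
      (fun x => hasDerivWithinAt_comp_add_const (hasDerivWithinAt_perBern m _))
      (fun y _ => (hM _).trans (le_max_left _ _)) ((hN s).mono (le_max_right _ _))⟩

/-- Continuous functions of mean zero on `[0,1]` whose `k`-th Walsh coefficient is bounded by
`M b ^ (-μ_m(k))`. The Sobolev kernel of order `m` is a superposition of products `F(x) F(y)` of
such functions `F`. -/
structure IsFeature (b : ℕ) [NeZero b] (m : ℕ) (M : ℝ) (F : ℝ → ℝ) : Prop where
  continuous : Continuous F
  integral_eq_zero : ∫ x in (0 : ℝ)..1, F x = 0
  norm_walshCoeff_le : ∀ k,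
    ‖walshCoeff b k fun d => (F (Real.ofDigits d) : ℂ)‖ ≤ M * ((b : ℝ) ^ mu b m k)⁻¹

theorem exists_isFeature_bern (hb : 1 < b) (m : ℕ) {l : ℕ} (hl : l ≠ 0) :
    ∃ M, IsFeature b m M (bern l) :=
  (exists_walshDecay_bern hb m l).imp fun _ hM =>
    ⟨continuous_bern l, integral_bern hl, hM.norm_walshCoeff_le hb (continuous_bern l)⟩

theorem exists_isFeature_perBern (hb : 1 < b) {m : ℕ} (hm : 2 ≤ m) :
    ∃ M, ∀ s, IsFeature b m M fun x => perBern m (x + s) := by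
  obtain ⟨M, hM⟩ := exists_walshDecay_perBern hb (m := m) (by omega)
  have hcont : ∀ s, Continuous fun x => perBern m (x + s) := fun s =>
    (continuous_perBern (by omega)).comp (continuous_add_const s)
  exact ⟨M, fun s => ⟨hcont s, integral_perBern_add (by omega) s,
    (hM s).norm_walshCoeff_le hb (hcont s)⟩⟩

theorem exists_sum_add_integral_le (hb : 1 < b) {α : ℕ} (hα : 2 ≤ α) :
    ∃ C : ℝ, 0 ≤ C ∧ ∀ (Φ : (ℝ → ℝ) → ℝ) (q : ℝ), (∀ F, 0 ≤ Φ F) →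
      (∀ M F, IsFeature b α M F → Φ F ≤ M ^ 2 * q) →
      ∑ l ∈ Finset.Icc 1 α, Φ (bern l) + ∫ t in (0 : ℝ)..1, Φ (fun x => perBern α (x + t))
        ≤ C * q := by
  choose! M hM using fun l (hl : l ≠ 0) => exists_isFeature_bern (b := b) hb α hl
  obtain ⟨N, hN⟩ := exists_isFeature_perBern (b := b) hb hα
  refine ⟨∑ l ∈ Finset.Icc 1 α, M l ^ 2 + N ^ 2, by positivity, fun Φ q hΦ hle => ?_⟩
  rw [add_mul, Finset.sum_mul]
  refine add_le_add (Finset.sum_le_sum fun l hl => hle _ _ (hM l ?_)) ?_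
  · exact Nat.one_le_iff_ne_zero.1 (Finset.mem_Icc.1 hl).1
  · have hnorm := intervalIntegral.norm_integral_le_of_norm_le_const (a := 0) (b := 1)
      (f := fun t => Φ fun x => perBern α (x + t)) (C := N ^ 2 * q) fun t _ => by
        rw [Real.norm_of_nonneg (hΦ _)]
        exact hle _ _ (hN t)
    simpa using (Real.le_norm_self _).trans hnorm

theorem walshCoeff_zero_comp_ofDigits (hb : 1 < b) {F : ℝ → ℝ} (hF : Continuous F) :
    walshCoeff b 0 (fun d => (F (Real.ofDigits d) : ℂ)) = ∫ x in (0 : ℝ)..1, F x := by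
  have hcont : Continuous fun d : ℕ → Fin b => (F (Real.ofDigits d) : ℂ) :=
    Complex.continuous_ofReal.comp (hF.comp Real.continuous_ofDigits)
  simp only [walshCoeff, walsh_zero hb, map_one, one_mul]
  rw [integral_digitMeasure hcont, intervalIntegral.integral_of_le zero_le_one,
    ← integral_Ico_eq_integral_Ioc, ← integral_complex_ofReal]
  exact setIntegral_congr_fun measurableSet_Ico fun x hx => by
    simp only [Real.ofDigits_digits hb hx]

end Feature

/-! ### Weights -/

section Weights

variable {b : ℕ}

theorem dropLead_zero (b : ℕ) : dropLead b 0 = 0 := Nat.zero_mod _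

theorem mu_eq_add {α : ℕ} (hα : 2 ≤ α) (k : ℕ) :
    mu b α k = mu b 1 k + mu b 1 (dropLead b k) + mu b (α - 2) (dropLead b (dropLead b k)) := by
  obtain ⟨m, rfl⟩ := Nat.exists_eq_add_of_le' hα
  rw [Nat.add_sub_cancel]
  by_cases hk : k = 0
  · simp [hk, mu_index_zero, dropLead_zero]
  by_cases hk' : dropLead b k = 0
  · simp [mu, hk, hk', mu_index_zero, dropLead_zero]
  · simp [mu, hk, hk', add_assoc]

theorem dotWeightSq_nonneg (b α k : ℕ) : 0 ≤ dotWeightSq b α k :=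
  Real.rpow_nonneg (Nat.cast_nonneg b) _

theorem ddotWeightSq_nonneg (b α : ℕ) (τ ζ : ℝ) (k : ℕ) : 0 ≤ ddotWeightSq b α τ ζ k :=
  Real.rpow_nonneg (Nat.cast_nonneg b) _

theorem ddotWeightSq_zero_zero (b α k : ℕ) :
    ddotWeightSq b α 0 0 k = ((b : ℝ) ^ mu b α k)⁻¹ := by
  rw [ddotWeightSq, zero_mul, zero_mul, sub_zero, sub_zero, Real.rpow_neg (Nat.cast_nonneg b),
    Real.rpow_natCast]

theorem dotWeightSq_eq_mul (hb : 1 < b) (α : ℕ) (τ ζ : ℝ) (k : ℕ) :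
    dotWeightSq b α k = ddotWeightSq b α (-τ) (-ζ) k * ddotWeightSq b α τ ζ k := by
  have hb0 : (0 : ℝ) < b := by positivity
  rw [dotWeightSq, ddotWeightSq, ddotWeightSq, ← Real.rpow_add hb0]
  congr 1
  ring

theorem dotWeightSq_eq_sq (hb : 1 < b) (α k : ℕ) :
    dotWeightSq b α k = ((b : ℝ) ^ mu b α k)⁻¹ ^ 2 := by
  rw [dotWeightSq_eq_mul hb α 0 0, neg_zero, ddotWeightSq_zero_zero, sq]

theorem ddotWeightSq_anti (hb : 1 < b) (α : ℕ) {τ₁ τ₂ ζ₁ ζ₂ : ℝ} (hτ : τ₂ ≤ τ₁) (hζ : ζ₂ ≤ ζ₁)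
    (k : ℕ) : ddotWeightSq b α τ₁ ζ₁ k ≤ ddotWeightSq b α τ₂ ζ₂ k :=
  Real.rpow_le_rpow_of_exponent_le (by exact_mod_cast hb.le) (by gcongr)

theorem dotWeightSq_le_ddotWeightSq (hb : 1 < b) {α : ℕ} (hα : 2 ≤ α) {τ ζ : ℝ} (hτ : τ ≤ 1)
    (hζ : ζ ≤ 1) (k : ℕ) : dotWeightSq b α k ≤ ddotWeightSq b α τ ζ k := by
  refine le_trans (Real.rpow_le_rpow_of_exponent_le (by exact_mod_cast hb.le) ?_)
    (ddotWeightSq_anti hb α hτ hζ k)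
  rw [mu_eq_add hα]
  push_cast
  linarith [(mu b 1 k).cast_nonneg (α := ℝ)]

theorem log_mul_pow_add {κ n j : ℕ} (hκ0 : 0 < κ) (hκ : κ < b) (hj : j < b ^ n) :
    Nat.log b (κ * b ^ n + j) = n := by
  refine Nat.log_eq_of_pow_le_of_lt_pow
    ((Nat.le_mul_of_pos_left _ hκ0).trans (Nat.le_add_right _ _)) ?_
  calc κ * b ^ n + j < (κ + 1) * b ^ n := by rw [add_mul, one_mul]; omega
    _ ≤ b ^ (n + 1) := by rw [pow_succ']; exact Nat.mul_le_mul_right _ hκ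

theorem mu_one_mul_pow_add {κ n j : ℕ} (hκ0 : 0 < κ) (hκ : κ < b) (hj : j < b ^ n) :
    mu b 1 (κ * b ^ n + j) = n + 1 := by
  have hpos : 0 < κ * b ^ n := Nat.mul_pos hκ0 (by omega)
  rw [mu, if_neg (by omega), log_mul_pow_add hκ0 hκ hj, mu]

theorem dropLead_mul_pow_add {κ n j : ℕ} (hκ0 : 0 < κ) (hκ : κ < b) (hj : j < b ^ n) :
    dropLead b (κ * b ^ n + j) = j := by
  rw [dropLead, log_mul_pow_add hκ0 hκ hj, Nat.mul_add_mod', Nat.mod_eq_of_lt hj]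

theorem sum_range_pow_succ_le (hb : b ≠ 0) {f : ℕ → ℝ} {n : ℕ} {B : ℝ} (hB : 0 ≤ B)
    (h : ∀ κ, 0 < κ → κ < b → ∑ j ∈ Finset.range (b ^ n), f (κ * b ^ n + j) ≤ B) :
    ∑ k ∈ Finset.range (b ^ (n + 1)), f k ≤ ∑ k ∈ Finset.range (b ^ n), f k + b * B := by
  obtain ⟨m, rfl⟩ := Nat.exists_eq_succ_of_ne_zero hb
  rw [pow_succ', sum_range_mul, Finset.sum_range_succ', add_comm]
  simp only [zero_mul, zero_add]
  gcongr
  refine (Finset.sum_le_card_nsmul _ _ B fun κ hκ => h (κ + 1) κ.succ_pos ?_).trans ?_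
  · simpa using hκ
  · rw [Finset.card_range, nsmul_eq_mul]
    gcongr
    omega

theorem sum_pow_mu_one_le (hb : 1 < b) {q : ℝ} (hq : 0 ≤ q) (hbq : 1 ≤ b * q) (n : ℕ) :
    ∑ j ∈ Finset.range (b ^ n), q ^ mu b 1 j ≤ ((n : ℝ) + 1) * (b * q) ^ n := by
  induction n with
  | zero => simp [mu]
  | succ n ih =>
    have hblock : ∀ κ, 0 < κ → κ < b →
        ∑ j ∈ Finset.range (b ^ n), q ^ mu b 1 (κ * b ^ n + j) ≤ b ^ n * q ^ (n + 1) :=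
      fun κ hκ0 hκ => by
        rw [Finset.sum_congr rfl fun j hj => by
          rw [mu_one_mul_pow_add hκ0 hκ (Finset.mem_range.1 hj)]]
        simp
    calc ∑ j ∈ Finset.range (b ^ (n + 1)), q ^ mu b 1 j
        ≤ (n + 1) * (b * q) ^ n + b * (b ^ n * q ^ (n + 1)) :=
          (sum_range_pow_succ_le (by omega) (by positivity) hblock).trans (by gcongr)
      _ = (n + 1) * (b * q) ^ n + (b * q) ^ (n + 1) := by ring
      _ ≤ (n + 1) * (b * q) ^ (n + 1) + (b * q) ^ (n + 1) := by
          gcongr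
          exact n.le_succ
      _ = ((n + 1 : ℕ) + 1) * (b * q) ^ (n + 1) := by
          push_cast
          ring

theorem sum_inv_pow_mu_one_mul_le (hb : 1 < b) {q : ℝ} (hq : 0 ≤ q) (hbq : 1 ≤ b * q) (n : ℕ) :
    ∑ k ∈ Finset.range (b ^ n), ((b : ℝ) ^ mu b 1 k)⁻¹ * q ^ mu b 1 (dropLead b k)
      ≤ 1 + ∑ i ∈ Finset.range n, ((i : ℝ) + 1) * q ^ i := by
  induction n with
  | zero => simp [mu, dropLead_zero]
  | succ n ih =>
    set B := ((b : ℝ) ^ (n + 1))⁻¹ * ((n + 1) * (b * q) ^ n) with hB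
    have hblock : ∀ κ, 0 < κ → κ < b → ∑ j ∈ Finset.range (b ^ n),
        ((b : ℝ) ^ mu b 1 (κ * b ^ n + j))⁻¹ * q ^ mu b 1 (dropLead b (κ * b ^ n + j)) ≤ B :=
      fun κ hκ0 hκ => by
        rw [Finset.sum_congr rfl fun j hj => by
          rw [mu_one_mul_pow_add hκ0 hκ (Finset.mem_range.1 hj),
            dropLead_mul_pow_add hκ0 hκ (Finset.mem_range.1 hj)], ← Finset.mul_sum]
        exact mul_le_mul_of_nonneg_left (sum_pow_mu_one_le hb hq hbq n) (by positivity)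
    have hbB : b * B = (n + 1) * q ^ n := by
      rw [hB, mul_pow, pow_succ]
      field_simp
    rw [Finset.sum_range_succ, ← add_assoc, ← hbB]
    exact (sum_range_pow_succ_le (by omega) (by positivity) hblock).trans (by gcongr)

theorem summable_inv_pow_mu_one_mul (hb : 1 < b) {q : ℝ} (hbq : 1 ≤ b * q) (hq1 : q < 1) :
    Summable fun k : ℕ => ((b : ℝ) ^ mu b 1 k)⁻¹ * q ^ mu b 1 (dropLead b k) := by
  have hq : 0 ≤ q := by
    by_contra! hneg
    linarith [mul_nonpos_of_nonneg_of_nonpos (Nat.cast_nonneg (α := ℝ) b) hneg.le]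
  have hgeom : Summable fun i : ℕ => ((i : ℝ) + 1) * q ^ i := by
    simpa [add_mul] using (summable_pow_mul_geometric_of_norm_lt_one (R := ℝ) 1
      (by rwa [Real.norm_of_nonneg hq])).add (summable_geometric_of_lt_one hq hq1)
  refine summable_of_sum_range_le (c := 1 + ∑' i : ℕ, ((i : ℝ) + 1) * q ^ i)
    (fun k => by positivity) fun n => ?_
  calc _ ≤ _ := Finset.sum_le_sum_of_subset_of_nonneg
        (Finset.range_subset_range.2 (Nat.lt_pow_self hb).le) fun k _ _ => by positivity
    _ ≤ 1 + ∑ i ∈ Finset.range n, ((i : ℝ) + 1) * q ^ i := sum_inv_pow_mu_one_mul_le hb hq hbq n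
    _ ≤ _ := by
        gcongr
        exact hgeom.sum_le_tsum _ fun i _ => by positivity

theorem summable_ddotWeightSq (hb : 1 < b) {α : ℕ} (hα : 2 ≤ α) {τ ζ : ℝ} (hτ : -1 < τ)
    (hζ : -1 ≤ ζ) : Summable (ddotWeightSq b α τ ζ) := by
  have hb1 : (1 : ℝ) < b := by exact_mod_cast hb
  have hb0 : (0 : ℝ) < b := by positivity
  obtain ⟨r, hr, hr0, hrτ⟩ : ∃ r, -1 < r ∧ r ≤ 0 ∧ r ≤ τ :=
    ⟨min τ 0, lt_min hτ (by norm_num), min_le_right _ _, min_le_left _ _⟩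
  have hsum := summable_inv_pow_mu_one_mul hb (q := (b : ℝ) ^ (-(1 + r)))
    (by
      rw [neg_add, Real.rpow_add hb0, Real.rpow_neg_one, mul_inv_cancel_left₀ hb0.ne']
      exact Real.one_le_rpow hb1.le (by linarith))
    (Real.rpow_lt_one_of_one_lt_of_neg hb1 (by linarith))
  refine hsum.of_nonneg_of_le (ddotWeightSq_nonneg b α τ ζ) fun k => ?_
  calc ddotWeightSq b α τ ζ k ≤ ddotWeightSq b α r (-1) k := ddotWeightSq_anti hb α hrτ hζ k
    _ = ((b : ℝ) ^ mu b 1 k)⁻¹ * ((b : ℝ) ^ (-(1 + r))) ^ mu b 1 (dropLead b k) := by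
        rw [ddotWeightSq, mu_eq_add hα, ← Real.rpow_natCast, ← Real.rpow_natCast,
          ← Real.rpow_neg hb0.le, ← Real.rpow_mul hb0.le, ← Real.rpow_add hb0]
        push_cast
        congr 1
        ring

theorem summable_dotWeightSq (hb : 1 < b) {α : ℕ} (hα : 2 ≤ α) : Summable (dotWeightSq b α) :=
  (summable_ddotWeightSq hb hα (τ := 0) (ζ := 0) (by norm_num) (by norm_num)).of_nonneg_of_le
    (dotWeightSq_nonneg b α) (dotWeightSq_le_ddotWeightSq hb hα zero_le_one zero_le_one)

end Weights

/-! ### Walsh kernels -/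

section WalshKernel

/-- The combination `∑ c(x) wal_k(D(x))` of values of the `k`-th Walsh function. -/
noncomputable def walshSum {X : Type} (b : ℕ) (s : Finset X) (c : X → ℝ) (D : X → ℕ → Fin b)
    (k : ℕ) : ℂ :=
  ∑ x ∈ s, (c x : ℂ) * walsh b k (D x)

variable {X : Type} {b : ℕ}

theorem walshSum_add (hb : 1 < b) (s : Finset X) (c : X → ℝ) (D : X → ℕ → Fin b)
    (d : ℕ → Fin b) (k : ℕ) :
    walshSum b s c (fun x => D x + d) k = walshSum b s c D k * walsh b k d := by
  simp_rw [walshSum, walsh_add hb, Finset.sum_mul, mul_assoc]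

theorem norm_walshSum_le (hb : 1 < b) (s : Finset X) (c : X → ℝ) (D : X → ℕ → Fin b) (k : ℕ) :
    ‖walshSum b s c D k‖ ≤ ∑ x ∈ s, |c x| :=
  norm_sum_le_of_le s fun x _ => by rw [norm_mul, norm_walsh hb, mul_one, Complex.norm_real,
    Real.norm_eq_abs]

variable [NeZero b]

theorem norm_sq_walshSum (hb : 1 < b) (s : Finset X) (c : X → ℝ) (D : X → ℕ → Fin b) (k : ℕ) :
    ‖walshSum b s c D k‖ ^ 2 = quadForm (fun x y => (walsh b k (D x - D y)).re) s c := by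
  rw [← Complex.ofReal_re (‖_‖ ^ 2), Complex.ofReal_pow, ← Complex.mul_conj', walshSum, map_sum,
    Finset.sum_mul_sum, Complex.re_sum]
  refine Finset.sum_congr rfl fun x _ => ?_
  rw [Complex.re_sum]
  refine Finset.sum_congr rfl fun y _ => ?_
  rw [map_mul, Complex.conj_ofReal, mul_mul_mul_comm, ← walsh_sub hb, ← Complex.ofReal_mul,
    Complex.re_ofReal_mul]

theorem hasSum_walshKernel (hb : 1 < b) {w : ℕ → ℝ} (hw : Summable fun k : ℕ+ => w k) (x y : ℝ) :
    HasSum (fun k : ℕ+ => w k * (walsh b k (digitSub b x y)).re) (walshKernel b w x y) := by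
  have hsum : Summable fun k : ℕ+ => (w k : ℂ) * walsh b k (digitSub b x y) := by
    refine Summable.of_norm ?_
    simp_rw [norm_mul, norm_walsh hb, mul_one, Complex.norm_real]
    exact hw.norm
  simp_rw [walshKernel, ← Complex.re_ofReal_mul]
  exact Complex.hasSum_re hsum.hasSum

theorem walshKernel_symm (hb : 1 < b) {w : ℕ → ℝ} (hw : Summable fun k : ℕ+ => w k) (x y : ℝ) :
    walshKernel b w x y = walshKernel b w y x := by
  have hre : ∀ k, (walsh b k (digitSub b x y)).re = (walsh b k (digitSub b y x)).re := fun k => by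
    rw [digitSub, digitSub, walsh_sub hb, walsh_sub hb, ← Complex.conj_re, map_mul,
      Complex.conj_conj, mul_comm]
  refine (hasSum_walshKernel hb hw x y).unique ?_
  simpa only [hre] using hasSum_walshKernel hb hw y x

theorem hasSum_quadForm_walshKernel (hb : 1 < b) {w : ℕ → ℝ} (hw : Summable fun k : ℕ+ => w k)
    (p : X → ℝ) (s : Finset X) (c : X → ℝ) :
    HasSum (fun k : ℕ+ => w k * ‖walshSum b s c (fun x => Real.digits (p x) b) k‖ ^ 2)
      (quadForm (fun x y => walshKernel b w (p x) (p y)) s c) := by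
  have hterm : ∀ k : ℕ+, w k * ‖walshSum b s c (fun x => Real.digits (p x) b) k‖ ^ 2
      = ∑ x ∈ s, ∑ y ∈ s, c x * c y * (w k * (walsh b k (digitSub b (p x) (p y))).re) := fun k => by
    rw [norm_sq_walshSum hb, quadForm]
    simp_rw [Finset.mul_sum, digitSub]
    exact Finset.sum_congr rfl fun x _ => Finset.sum_congr rfl fun y _ => by ring
  simp_rw [hterm]
  exact hasSum_sum fun x _ => hasSum_sum fun y _ => (hasSum_walshKernel hb hw _ _).mul_left _

theorem posSemidef_walshKernel (hb : 1 < b) {w : ℕ → ℝ} (hw0 : ∀ k, 0 ≤ w k)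
    (hw : Summable fun k : ℕ+ => w k) (p : X → ℝ) :
    (Matrix.of fun x y => walshKernel b w (p x) (p y)).PosSemidef :=
  posSemidef_of_quadForm_nonneg (fun x y => walshKernel_symm hb hw (p x) (p y)) fun s c =>
    (hasSum_quadForm_walshKernel hb hw p s c).nonneg fun k : ℕ+ =>
      mul_nonneg (hw0 k) (sq_nonneg _)

theorem rkhs_subset_walshKernel (hb : 1 < b) {w : ℕ → ℝ} (hw0 : ∀ k, 0 ≤ w k)
    (hw : Summable fun k : ℕ+ => w k) {K : X → X → ℝ} {p : X → ℝ}
    (h : IsDominated K fun x y => walshKernel b w (p x) (p y)) :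
    rkhs K ⊆ rkhs fun x y => walshKernel b w (p x) (p y) :=
  rkhs_subset_of_isDominated (posSemidef_walshKernel hb hw0 hw p) h

theorem isDominated_walshKernel_of_le (hb : 1 < b) {v w : ℕ → ℝ} (hv0 : ∀ k, 0 ≤ v k)
    (hvw : ∀ k, v k ≤ w k) (hw : Summable fun k : ℕ+ => w k) (p : X → ℝ) :
    IsDominated (fun x y => walshKernel b v (p x) (p y))
      fun x y => walshKernel b w (p x) (p y) := by
  have hv : Summable fun k : ℕ+ => v k := hw.of_nonneg_of_le (fun k => hv0 k) fun k => hvw k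
  refine ⟨1, zero_le_one, fun s c => ?_⟩
  rw [one_mul]
  exact hasSum_le (fun k : ℕ+ => mul_le_mul_of_nonneg_right (hvw k) (sq_nonneg _))
    (hasSum_quadForm_walshKernel hb hv p s c) (hasSum_quadForm_walshKernel hb hw p s c)

end WalshKernel

/-! ### Domination of the Sobolev kernel and of its digitally shift-invariant mean -/

section Domination

open MeasureTheory

theorem norm_sq_le_mul_of_hasSum {ι E : Type*} [SeminormedAddCommGroup E] {f : ι → E}
    {u v : ι → ℝ} {T : E} {U V : ℝ} (hu0 : ∀ i, 0 ≤ u i) (hv0 : ∀ i, 0 ≤ v i)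
    (hfuv : ∀ i, ‖f i‖ ^ 2 ≤ u i * v i) (hf : HasSum f T) (hu : HasSum u U) (hv : HasSum v V) :
    ‖T‖ ^ 2 ≤ U * V := by
  refine le_of_tendsto (hf.norm.pow 2) (.of_forall fun s => ?_)
  calc ‖∑ i ∈ s, f i‖ ^ 2 ≤ (∑ i ∈ s, ‖f i‖) ^ 2 :=
        pow_le_pow_left₀ (norm_nonneg _) (norm_sum_le _ _) 2
    _ ≤ (∑ i ∈ s, u i) * ∑ i ∈ s, v i :=
        Finset.sum_sq_le_sum_mul_sum_of_sq_le_mul s (fun i _ => hu0 i) (fun i _ => hv0 i)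
          fun i _ => hfuv i
    _ ≤ U * V := mul_le_mul (sum_le_hasSum s (fun i _ => hu0 i) hu)
        (sum_le_hasSum s (fun i _ => hv0 i) hv) (Finset.sum_nonneg fun i _ => hv0 i) (hu.nonneg hu0)

theorem hasSum_pnat_of_apply_zero {G : Type*} [AddCommGroup G] [TopologicalSpace G]
    [IsTopologicalAddGroup G] {f : ℕ → G} {a : G} (hf0 : f 0 = 0) (hf : HasSum f a) :
    HasSum (fun k : ℕ+ => f k) a :=
  hasSum_pnat_iff.2 (by rwa [hf0, add_zero])

variable {X : Type} {b m : ℕ} [NeZero b] {M : ℝ} {F : ℝ → ℝ}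

namespace IsFeature

theorem norm_walshCoeff_sq_le (hb : 1 < b) (hF : IsFeature b m M F) (k : ℕ) :
    ‖walshCoeff b k fun d => (F (Real.ofDigits d) : ℂ)‖ ^ 2 ≤ M ^ 2 * dotWeightSq b m k := by
  rw [dotWeightSq_eq_sq hb, ← mul_pow]
  exact pow_le_pow_left₀ (norm_nonneg _) (hF.norm_walshCoeff_le k) 2

theorem walshCoeff_zero (hb : 1 < b) (hF : IsFeature b m M F) :
    walshCoeff b 0 (fun d => (F (Real.ofDigits d) : ℂ)) = 0 := by
  rw [walshCoeff_zero_comp_ofDigits hb hF.continuous, hF.integral_eq_zero, Complex.ofReal_zero]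

theorem summable_norm_walshCoeff (hb : 1 < b) (hm : 2 ≤ m) (hF : IsFeature b m M F) :
    Summable fun k => ‖walshCoeff b k fun d => (F (Real.ofDigits d) : ℂ)‖ := by
  have hsum := summable_ddotWeightSq hb hm (τ := 0) (ζ := 0) (by norm_num) (by norm_num)
  refine (hsum.mul_left M).of_nonneg_of_le (fun k => norm_nonneg _) fun k => ?_
  rw [ddotWeightSq_zero_zero]
  exact hF.norm_walshCoeff_le k

theorem hasSum_walshCoeff_mul_walshSum (hb : 1 < b) (hm : 2 ≤ m) (hF : IsFeature b m M F)
    (s : Finset X) (c : X → ℝ) (D : X → ℕ → Fin b) :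
    HasSum (fun k => walshCoeff b k (fun d => (F (Real.ofDigits d) : ℂ)) * walshSum b s c D k)
      ((∑ x ∈ s, c x * F (Real.ofDigits (D x)) : ℝ) : ℂ) := by
  have hcont : Continuous fun d : ℕ → Fin b => (F (Real.ofDigits d) : ℂ) :=
    Complex.continuous_ofReal.comp (hF.continuous.comp Real.continuous_ofDigits)
  have hpoint := hasSum_walshCoeff_mul_walsh hb hcont (hF.summable_norm_walshCoeff hb hm)
  simp_rw [walshSum, Finset.mul_sum, Complex.ofReal_sum, Complex.ofReal_mul, mul_left_comm]
  exact hasSum_sum fun x _ => (hpoint (D x)).mul_left _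

theorem sq_sum_le (hb : 1 < b) (hm : 2 ≤ m) (hF : IsFeature b m M F) {u v : ℕ → ℝ}
    (hu0 : ∀ k, 0 ≤ u k) (hv0 : ∀ k, 0 ≤ v k) (huv : ∀ k, dotWeightSq b m k ≤ u k * v k)
    (s : Finset X) (c : X → ℝ) (D : X → ℕ → Fin b) {U V : ℝ} (hU : HasSum (fun k : ℕ+ => u k) U)
    (hV : HasSum (fun k : ℕ+ => v k * ‖walshSum b s c D k‖ ^ 2) V) :
    (∑ x ∈ s, c x * F (Real.ofDigits (D x))) ^ 2 ≤ M ^ 2 * (U * V) := by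
  have hsum := hasSum_pnat_of_apply_zero (by rw [hF.walshCoeff_zero hb, zero_mul])
    (hF.hasSum_walshCoeff_mul_walshSum hb hm s c D)
  rw [← sq_abs, ← Real.norm_eq_abs, ← Complex.norm_real, ← mul_assoc]
  refine norm_sq_le_mul_of_hasSum (fun k : ℕ+ => mul_nonneg (sq_nonneg M) (hu0 k))
    (fun k : ℕ+ => mul_nonneg (hv0 k) (sq_nonneg _)) (fun k => ?_) hsum (hU.mul_left _) hV
  calc _ ≤ M ^ 2 * (u k * v k) * ‖walshSum b s c D k‖ ^ 2 := by
        rw [norm_mul, mul_pow]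
        exact mul_le_mul_of_nonneg_right ((hF.norm_walshCoeff_sq_le hb k).trans
          (mul_le_mul_of_nonneg_left (huv k) (sq_nonneg M))) (sq_nonneg _)
    _ = M ^ 2 * u k * (v k * ‖walshSum b s c D k‖ ^ 2) := by ring

theorem integral_sq_sum_le (hb : 1 < b) (hm : 2 ≤ m) (hF : IsFeature b m M F)
    (s : Finset X) (c : X → ℝ) (D : X → ℕ → Fin b) {V : ℝ}
    (hV : HasSum (fun k : ℕ+ => dotWeightSq b m k * ‖walshSum b s c D k‖ ^ 2) V) :
    ∫ d, (∑ x ∈ s, c x * F (Real.ofDigits (D x + d))) ^ 2 ∂digitMeasure b ≤ M ^ 2 * V := by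
  set A : ℕ → ℂ := fun k =>
    walshCoeff b k (fun d => (F (Real.ofDigits d) : ℂ)) * walshSum b s c D k with hA_def
  have hA : Summable fun k => ‖A k‖ := by
    simp_rw [hA_def, norm_mul]
    exact ((hF.summable_norm_walshCoeff hb hm).mul_right (∑ x ∈ s, |c x|)).of_nonneg_of_le
      (fun k => by positivity) fun k => by gcongr; exact norm_walshSum_le hb s c D k
  have hshift : ∀ d, (∑ x ∈ s, c x * F (Real.ofDigits (D x + d))) ^ 2
      = ‖∑' k, A k * walsh b k d‖ ^ 2 := fun d => by
    have hsum := hF.hasSum_walshCoeff_mul_walshSum hb hm s c fun x => D x + d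
    simp_rw [walshSum_add hb, ← mul_assoc] at hsum
    rw [hsum.tsum_eq, Complex.norm_real, Real.norm_eq_abs, sq_abs]
  have hA0 : ‖A 0‖ ^ 2 = 0 := by simp [hA_def, hF.walshCoeff_zero hb]
  simp_rw [hshift]
  refine hasSum_le (fun k : ℕ+ => ?_)
    (hasSum_pnat_of_apply_zero hA0 (hasSum_norm_sq_integral hb hA)) (hV.mul_left (M ^ 2))
  rw [norm_mul, mul_pow, ← mul_assoc]
  exact mul_le_mul_of_nonneg_right (hF.norm_walshCoeff_sq_le hb k) (sq_nonneg _)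

end IsFeature

theorem isDominated_sobolevKernel_ddotKernel (hb : 1 < b) {α : ℕ} (hα : 2 ≤ α) {τ ζ : ℝ}
    (hτ : τ < 1) (hζ : ζ ≤ 1) (hw : Summable fun k : ℕ+ => ddotWeightSq b α τ ζ k) :
    IsDominated (fun x y : Unit01 => sobolevKernel α x y)
      fun x y : Unit01 => ddotKernel b α τ ζ x y := by
  have hE := ((summable_ddotWeightSq hb hα (τ := -τ) (ζ := -ζ) (by linarith)
    (by linarith)).comp_injective PNat.coe_injective).hasSum
  set E := ∑' k : ℕ+, (ddotWeightSq b α (-τ) (-ζ) ∘ PNat.val) k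
  have hE0 : 0 ≤ E := hE.nonneg fun k => ddotWeightSq_nonneg _ _ _ _ _
  obtain ⟨C, hC, hfeature⟩ := exists_sum_add_integral_le hb hα
  refine ⟨C * E, mul_nonneg hC hE0, fun s c => ?_⟩
  rw [quadForm_sobolevKernel hα, mul_assoc]
  refine hfeature (fun F => (∑ x ∈ s, c x * F x) ^ 2) _ (fun F => sq_nonneg _) fun M F hF => ?_
  have hbound := hF.sq_sum_le hb hα (ddotWeightSq_nonneg b α (-τ) (-ζ))
    (ddotWeightSq_nonneg b α τ ζ) (fun k => (dotWeightSq_eq_mul hb α τ ζ k).le) s c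
    (fun x => Real.digits x b) hE (hasSum_quadForm_walshKernel hb hw _ s c)
  simpa only [Real.ofDigits_digits hb (Subtype.prop _), ddotKernel] using hbound

theorem quadForm_dsiKernel {K : ℝ → ℝ → ℝ} (hK : Continuous fun p : ℝ × ℝ => K p.1 p.2)
    (p : X → ℝ) (s : Finset X) (c : X → ℝ) :
    quadForm (fun x y => dsiKernel b K (p x) (p y)) s c
      = ∫ d, quadForm (fun x y => K (Real.ofDigits (Real.digits (p x) b + d))
          (Real.ofDigits (Real.digits (p y) b + d))) s c ∂digitMeasure b := by
  have hcont : ∀ x y, Continuous fun d => K (Real.ofDigits (Real.digits (p x) b + d))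
      (Real.ofDigits (Real.digits (p y) b + d)) := fun x y =>
    hK.comp ((Real.continuous_ofDigits.comp (continuous_const_add _)).prodMk
      (Real.continuous_ofDigits.comp (continuous_const_add _)))
  have hint : ∀ x y, Integrable (fun d => c x * c y * K (Real.ofDigits (Real.digits (p x) b + d))
      (Real.ofDigits (Real.digits (p y) b + d))) (digitMeasure b) := fun x y =>
    (integrable_digitMeasure (hcont x y)).const_mul _
  simp only [quadForm]
  rw [integral_finsetSum _ fun x _ => integrable_finsetSum _ fun y _ => hint x y]
  refine Finset.sum_congr rfl fun x _ => ?_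
  rw [integral_finsetSum _ fun y _ => hint x y]
  refine Finset.sum_congr rfl fun y _ => ?_
  rw [integral_const_mul, integral_digitMeasure (hcont x y)]
  rfl

theorem intervalIntegral_integral_digitMeasure_swap {E : Type*} [NormedAddCommGroup E]
    [NormedSpace ℝ E] {f : (ℕ → Fin b) → ℝ → E} (hf : Continuous (Function.uncurry f)) (u v : ℝ) :
    ∫ t in u..v, ∫ d, f d t ∂digitMeasure b = ∫ d, (∫ t in u..v, f d t) ∂digitMeasure b := by
  refine intervalIntegral_integral_swap ?_
  have hcompact : IntegrableOn (Function.uncurry fun t d => f d t) (Set.uIcc u v ×ˢ Set.univ)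
      (volume.prod (digitMeasure b)) :=
    (hf.comp continuous_swap).continuousOn.integrableOn_compact
      (isCompact_uIcc.prod isCompact_univ)
  rw [← (digitMeasure b).restrict_univ, Measure.prod_restrict]
  exact hcompact.mono_set (Set.prod_mono_left Set.uIoc_subset_uIcc)

theorem integral_quadForm_sobolevKernel {α : ℕ} (hα : 2 ≤ α) (s : Finset X) (c : X → ℝ)
    (D : X → ℕ → Fin b) :
    ∫ d, quadForm (fun x y => sobolevKernel α (Real.ofDigits (D x + d))
        (Real.ofDigits (D y + d))) s c ∂digitMeasure b
      = ∑ l ∈ Finset.Icc 1 α,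
          ∫ d, (∑ x ∈ s, c x * bern l (Real.ofDigits (D x + d))) ^ 2 ∂digitMeasure b
        + ∫ t in (0 : ℝ)..1,
          ∫ d, (∑ x ∈ s, c x * perBern α (Real.ofDigits (D x + d) + t)) ^ 2 ∂digitMeasure b := by
  have hpoint : ∀ x, Continuous fun d => Real.ofDigits (D x + d) := fun x =>
    Real.continuous_ofDigits.comp (continuous_const_add _)
  have hbern : ∀ l, Continuous fun d => (∑ x ∈ s, c x * bern l (Real.ofDigits (D x + d))) ^ 2 :=
    fun l => by
      have := continuous_bern l
      fun_prop
  have hper : Continuous (Function.uncurry fun d t =>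
      (∑ x ∈ s, c x * perBern α (Real.ofDigits (D x + d) + t)) ^ 2) :=
    (continuous_finsetSum s fun x _ => ((continuous_perBern (by omega)).comp
      (((hpoint x).comp continuous_fst).add continuous_snd)).const_mul (c x)).pow 2
  simp_rw [quadForm_sobolevKernel hα]
  rw [integral_add (integrable_finsetSum _ fun l _ => integrable_digitMeasure (hbern l))
      (integrable_digitMeasure
        (intervalIntegral.continuous_parametric_intervalIntegral_of_continuous' hper 0 1)),
    integral_finsetSum _ fun l _ => integrable_digitMeasure (hbern l),
    intervalIntegral_integral_digitMeasure_swap hper]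

theorem isDominated_dsiKernel_dotKernel (hb : 1 < b) {α : ℕ} (hα : 2 ≤ α) :
    IsDominated (fun x y : Unit01 => dsiKernel b (sobolevKernel α) x y)
      fun x y : Unit01 => dotKernel b α x y := by
  obtain ⟨C, hC, hfeature⟩ := exists_sum_add_integral_le hb hα
  refine ⟨C, hC, fun s c => ?_⟩
  rw [quadForm_dsiKernel (continuous_sobolevKernel α) Subtype.val,
    integral_quadForm_sobolevKernel hα]
  refine hfeature (fun F => ∫ d, (∑ x ∈ s, c x * F (Real.ofDigits (Real.digits x b + d))) ^ 2
    ∂digitMeasure b) _ (fun F => integral_nonneg fun d => sq_nonneg _) fun M F hF => ?_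
  exact hF.integral_sq_sum_le hb hα s c (fun x => Real.digits x b)
    (hasSum_quadForm_walshKernel hb
      ((summable_dotWeightSq hb hα).comp_injective PNat.coe_injective) _ s c)

end Domination

end DSI

open DSI in
theorem mainTheorem2_general (b : ℕ) [NeZero b] (hb : 1 < b) (α : ℕ) (hα : 2 ≤ α) :
    (Summable fun k : ℕ+ => dotWeightSq b α k) ∧
    (∀ τ ζ : ℝ, -1 < τ → -1 ≤ ζ → Summable fun k : ℕ+ => ddotWeightSq b α τ ζ k) ∧
    rkhs01 (dsiKernel b (sobolevKernel α)) ⊆ rkhs01 (dotKernel b α) ∧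
    (∀ τ ζ : ℝ, τ ≤ 1 → ζ ≤ 1 → (Summable fun k : ℕ+ => ddotWeightSq b α τ ζ k) →
      rkhs01 (dotKernel b α) ⊆ rkhs01 (ddotKernel b α τ ζ)) ∧
    (∀ τ ζ : ℝ, τ < 1 → ζ ≤ 1 → (Summable fun k : ℕ+ => ddotWeightSq b α τ ζ k) →
      rkhs01 (sobolevKernel α) ⊆ rkhs01 (ddotKernel b α τ ζ)) ∧
    (∀ τ₁ τ₂ ζ₁ ζ₂ : ℝ, τ₂ ≤ τ₁ → ζ₂ ≤ ζ₁ →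
      (Summable fun k : ℕ+ => ddotWeightSq b α τ₂ ζ₂ k) →
      rkhs01 (ddotKernel b α τ₁ ζ₁) ⊆ rkhs01 (ddotKernel b α τ₂ ζ₂)) := by
  have hdot : Summable fun k : ℕ+ => dotWeightSq b α k :=
    (summable_dotWeightSq hb hα).comp_injective PNat.coe_injective
  refine ⟨hdot, fun τ ζ hτ hζ => ?_, ?_, fun τ ζ hτ hζ hw => ?_, fun τ ζ hτ hζ hw => ?_,
    fun τ₁ τ₂ ζ₁ ζ₂ hτ hζ hw => ?_⟩
  · exact (summable_ddotWeightSq hb hα hτ hζ).comp_injective PNat.coe_injective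
  · exact rkhs_subset_walshKernel hb (dotWeightSq_nonneg b α) hdot
      (isDominated_dsiKernel_dotKernel hb hα)
  · exact rkhs_subset_walshKernel hb (ddotWeightSq_nonneg b α τ ζ) hw
      (isDominated_walshKernel_of_le hb (dotWeightSq_nonneg b α)
        (dotWeightSq_le_ddotWeightSq hb hα hτ hζ) hw _)
  · exact rkhs_subset_walshKernel hb (ddotWeightSq_nonneg b α τ ζ) hw
      (isDominated_sobolevKernel_ddotKernel hb hα hτ hζ hw)
  · exact rkhs_subset_walshKernel hb (ddotWeightSq_nonneg b α τ₂ ζ₂) hw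
      (isDominated_walshKernel_of_le hb (ddotWeightSq_nonneg b α τ₁ ζ₁)
        (ddotWeightSq_anti hb α hτ hζ) hw _)

theorem mainTheorem2 (b : ℕ) [Fact b.Prime] (α : ℕ) (hα : 2 ≤ α) :
    -- the series that define the kernels `K̇_α` and `K̈_{α,τ,ζ}` converge
    (Summable fun k : ℕ+ => DSI.dotWeightSq b α k) ∧
    (∀ τ ζ : ℝ, -1 < τ → -1 ≤ ζ → Summable fun k : ℕ+ => DSI.ddotWeightSq b α τ ζ k) ∧
    -- the inclusions, for all parameters for which `K̈_{α,τ,ζ}` is defined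
    DSI.rkhs01 (DSI.dsiKernel b (DSI.sobolevKernel α)) ⊆ DSI.rkhs01 (DSI.dotKernel b α) ∧
    (∀ τ ζ : ℝ, τ < 1 → ζ ≤ 1 → (Summable fun k : ℕ+ => DSI.ddotWeightSq b α τ ζ k) →
      DSI.rkhs01 (DSI.dotKernel b α) ⊆ DSI.rkhs01 (DSI.ddotKernel b α τ ζ) ∧
      DSI.rkhs01 (DSI.sobolevKernel α) ⊆ DSI.rkhs01 (DSI.ddotKernel b α τ ζ)) ∧
    (∀ τ₁ τ₂ ζ₁ ζ₂ : ℝ, τ₁ < 1 → τ₂ < 1 → ζ₁ ≤ 1 → ζ₂ ≤ 1 → τ₂ ≤ τ₁ → ζ₂ ≤ ζ₁ →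
      (Summable fun k : ℕ+ => DSI.ddotWeightSq b α τ₂ ζ₂ k) →
      DSI.rkhs01 (DSI.ddotKernel b α τ₁ ζ₁) ⊆ DSI.rkhs01 (DSI.ddotKernel b α τ₂ ζ₂)) := by
  obtain ⟨hdot, hddot, hdsi, hle, hsob, hanti⟩ :=
    mainTheorem2_general b (Fact.out : b.Prime).one_lt α hα
  exact ⟨hdot, hddot, hdsi, fun τ ζ hτ hζ hw => ⟨hle τ ζ hτ.le hζ hw, hsob τ ζ hτ hζ hw⟩,
    fun τ₁ τ₂ ζ₁ ζ₂ _ _ _ _ => hanti τ₁ τ₂ ζ₁ ζ₂⟩
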